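/- Let $d\ge 1$, and let $\mathcal P_d$ be the set of partitions $\lambda=(\lambda_1\ge\dots\ge\lambda_d)$, $\lambda_i\in\mathbb N$. For $1\le m\le d$ put $m'=d+1-m$. The reverse Young diagram of $\mu\in\mathcal P_d$ is the right and bottom justified array of boxes with $\mu_1$ boxes in the bottom row, $\mu_2$ boxes in the row above it, and so on; its rows are numbered from bottom to top and its columns from right to left, starting with $1$, and $r(a)$, $c(a)$ denote the row and column number of an entry $a$. A reverse tableau of shape $\mu$ is a filling of this diagram with elements of $\{1,\dots,d\}$, weakly increasing along rows from left to right and strictly increasing down columns. The factorial Schur function of $\mu$ is $$s_\mu(x\,|\,y)=\sum_{R}\ \prod_{a\in R}\bigl(x_a-y_{a'+c(a)-r(a)}\bigr)\in\mathbb C[y_1,y_2,\dots][x_1,\dots,x_d],$$ the sum being over all reverse tableaux $R$ of shape $\mu$. For $\lambda,\mu\in\mathcal P_d$, let $\lambda*\mu$ be the skew diagram obtained by placing the Young diagram of $\lambda$ above and to the right of the reverse Young diagram of $\mu$. A skew barred tableau $L$ of shape $\lambda*\mu$ is a filling of the boxes of $\lambda$ with elements of $\{1,\dots,d\}$ and of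 the boxes of $\mu$ with elements of $\{1,\dots,d\}\cup\{\overline1,\dots,\overline d\}$ such that, disregarding bars, the values weakly increase along rows from left to right and strictly increase down columns. Its unbarred column word $L^u$ is the sequence of its unbarred entries, read down the columns, from the rightmost column to the leftmost. For $\nu\in\mathcal P_d$, let $\mathcal{LR}_{\lambda,\mu}^{\nu}$ be the set of skew barred tableaux $L$ of shape $\lambda*\mu$ such that $L^u$ contains exactly $\nu_k$ entries $k$ for each $k$, and every initial segment of $L^u$ contains at least as many $k$'s as $(k+1)$'s for $1\le k<d$. For a barred entry $a$ of $L$ let $|a|$ be its value without the bar, and let $\omega_a$ be the number of unbarred entries of value $|a|$ that are read before $a$. Put $$c_L=\prod_{a\in L\text{ barred}}\bigl(y_{|a|'+\omega_a}-y_{|a|'+c(a)-r(a)}\bigr),$$ where $c(a)$, $r(a)$ refer to the position of $a$ in $\mu$. Write $c_L>0$ if each factor in this product is of the form $y_i-y_j$ with $i>j$. Then for all $\lambda,\mu\in\mathcal P_d$ there is exactly one family $(c_{\lambda,\mu}^{\nu})_{\nu\in\mathcal P_d}$ of elements of $\mathbb C[y_1,y_2,\dots]$, only finitely many of them nonzero,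 such that $$s_\lambda(x\,|\,y)\,s_\mu(x\,|\,y)=\sum_{\nu\in\mathcal P_d}c_{\lambda,\mu}^{\nu}\,s_\nu(x\,|\,y),$$ and for every $\nu\in\mathcal P_d$ $$c_{\lambda,\mu}^{\nu}=\sum_{L\in\mathcal{LR}_{\lambda,\mu}^{\nu},\ c_L>0}c_L .$$ Moreover, each $c_L$ occurring in this sum is a (possibly empty) product of factors $y_i-y_j$ with $i>j$. -/

import Mathlib

namespace EquivLR

noncomputable section

open scoped Classical

/-- Partitions with at most `d` parts: weakly decreasing sequences `(λ_1, …, λ_d)` of natural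
numbers. The part `λ_k` is the value at the element `k - 1` of `Fin d`. -/
abbrev Partition (d : ℕ) : Type := {p : Fin d → ℕ // Antitone p}

/-- The boxes of the (reverse) Young diagram of `p`: the box in row `r` and column `c`
(`1 ≤ r ≤ d`, `1 ≤ c ≤ p_r`) is the pair `⟨r - 1, c - 1⟩`.

In a reverse Young diagram, rows are numbered from bottom to top and columns from right to left.
In an ordinary Young diagram, rows are numbered from top to bottom and columns from left to
right. -/
abbrev Cell {d : ℕ} (p : Partition d) : Type := Σ r : Fin d, Fin (p.1 r)

/-- The row number (starting from `1`) of a box. -/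
def Cell.row {d : ℕ} {p : Partition d} (b : Cell p) : ℕ := b.1.val + 1

/-- The column number (starting from `1`) of a box. -/
def Cell.col {d : ℕ} {p : Partition d} (b : Cell p) : ℕ := b.2.val + 1

/-- The polynomial ring `ℂ[y_1, y_2, …]`. -/
abbrev YRing : Type := MvPolynomial ℕ+ ℂ

/-- The variable `y_k`, for a positive natural number `k` (the value at `k = 0` is irrelevant:
see `index_pos` below). -/
def y (k : ℕ) : YRing := MvPolynomial.X k.toPNat'

/-- Entries of tableaux are numbers in `{1, …, d}`; the number `m` is the element `m - 1` of
`Fin d`. This is the involution `m' = d + 1 - m`. -/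
def flip {d : ℕ} (a : Fin d) : ℕ := d + 1 - (a.val + 1)

/-- The index `a' + c(a) - r(a)` belonging to the entry `a` in the box `b`. -/
def index {d : ℕ} {p : Partition d} (a : Fin d) (b : Cell p) : ℕ := flip a + b.col - b.row

/-- A reverse tableau of shape `μ` (with entries in `{1, …, d}`): the entries weakly increase
along rows from left to right and strictly increase down columns. -/
def IsReverseTableau {d : ℕ} {μ : Partition d} (R : Cell μ → Fin d) : Prop :=
  (∀ b b' : Cell μ, b.row = b'.row → b'.col ≤ b.col → R b ≤ R b') ∧
  (∀ b b' : Cell μ, b.col = b'.col → b'.row < b.row → R b < R b')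

/-- The indices `a' + c(a) - r(a)` occurring in a reverse tableau are positive, and the
subtraction in them is not truncated. -/
theorem index_pos {d : ℕ} {μ : Partition d} {R : Cell μ → Fin d} (hR : IsReverseTableau R)
    (b : Cell μ) : b.row < flip (R b) + b.col := by
  have key : ∀ (r : ℕ) (hr : r < d) (c : ℕ) (hc : c < μ.1 ⟨r, hr⟩),
      (R ⟨⟨r, hr⟩, ⟨c, hc⟩⟩).val + r < d := by
    intro r
    induction r with
    | zero => intro hr c hc; simp
    | succ r ih =>
      intro hr c hc
      have hr' : r < d := by omega
      have hle : μ.1 ⟨r + 1, hr⟩ ≤ μ.1 ⟨r, hr'⟩ := μ.2 (by simp [Fin.le_def])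
      have h1 := ih hr' c (lt_of_lt_of_le hc hle)
      have h2 := hR.2 ⟨⟨r + 1, hr⟩, ⟨c, hc⟩⟩ ⟨⟨r, hr'⟩, ⟨c, lt_of_lt_of_le hc hle⟩⟩
        rfl (by simp [Cell.row])
      rw [Fin.lt_def] at h2
      omega
  obtain ⟨⟨r, hr⟩, ⟨c, hc⟩⟩ := b
  have := key r hr c hc
  simp only [Cell.row, Cell.col, flip]
  omega

/-- The factorial Schur function `s_μ(x | y)`, as an element of `ℂ[y_1, y_2, …][x_1, …, x_d]`. -/
def factorialSchur {d : ℕ} (μ : Partition d) : MvPolynomial (Fin d) YRing :=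
  ∑ R : Cell μ → Fin d with IsReverseTableau R,
    ∏ b : Cell μ, (MvPolynomial.X (R b) - MvPolynomial.C (y (index (R b) b)))

/-- `c` is a family of coefficients `c_{λ,μ}^ν` in `ℂ[y_1, y_2, …]`, finitely many of them nonzero,
with `s_λ(x | y) s_μ(x | y) = ∑_ν c_{λ,μ}^ν s_ν(x | y)`. -/
def IsStructureConstants {d : ℕ} (lam μ : Partition d) (c : Partition d →₀ YRing) : Prop :=
  factorialSchur lam * factorialSchur μ = c.sum fun ν a => MvPolynomial.C a * factorialSchur ν

/-- The boxes of the skew diagram `λ * μ`: the Young diagram `λ` placed above and to the right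
of the reverse Young diagram `μ`. -/
abbrev Box {d : ℕ} (lam μ : Partition d) : Type := Cell lam ⊕ Cell μ

/-- The horizontal position in the plane (growing to the right) of a box of `λ * μ`: the columns
of `λ` are at `1, 2, …` from left to right, those of `μ` at `-1, -2, …` from right to left. -/
def Box.xpos {d : ℕ} {lam μ : Partition d} : Box lam μ → ℤ
  | .inl b => b.col
  | .inr b => -b.col

/-- The vertical position in the plane (growing downwards) of a box of `λ * μ`: the rows of `λ`
are at `-d, …, -1` from top to bottom, those of `μ` at `0, …, d - 1`, the bottom row being at
`d - 1`. (Empty rows between the two diagrams are immaterial.) -/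
def Box.ypos {d : ℕ} {lam μ : Partition d} : Box lam μ → ℤ
  | .inl b => (b.row : ℤ) - 1 - d
  | .inr b => (d : ℤ) - b.row

/-- A filling of `λ * μ`: the values in `{1, …, d}` (bars disregarded) of all the entries, and the
set of those boxes of `μ` whose entries are barred. Entries in `λ` are never barred. -/
abbrev Filling {d : ℕ} (lam μ : Partition d) : Type := (Box lam μ → Fin d) × Finset (Cell μ)

/-- Skew barred tableaux of shape `λ * μ`: without regard to bars, the entries weakly increase
along rows from left to right and strictly increase down columns. -/
def IsSkewBarredTableau {d : ℕ} {lam μ : Partition d} (L : Filling lam μ) : Prop :=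
  (∀ p q : Box lam μ, p.ypos = q.ypos → p.xpos ≤ q.xpos → L.1 p ≤ L.1 q) ∧
  (∀ p q : Box lam μ, p.xpos = q.xpos → p.ypos < q.ypos → L.1 p < L.1 q)

/-- The entry in the box `p` is barred. -/
def IsBarred {d : ℕ} {lam μ : Partition d} (L : Filling lam μ) (p : Box lam μ) : Prop :=
  ∃ b ∈ L.2, p = Sum.inr b

/-- The column reading order: `p` is read before `q`. Columns are read from right to left, each
of them from top to bottom. -/
def ReadBefore {d : ℕ} {lam μ : Partition d} (p q : Box lam μ) : Prop :=
  q.xpos < p.xpos ∨ (p.xpos = q.xpos ∧ p.ypos < q.ypos)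

/-- `ω(L^u)_k`: the number of `k`'s in the unbarred column word `L^u`. -/
def content {d : ℕ} {lam μ : Partition d} (L : Filling lam μ) (k : Fin d) : ℕ :=
  (Finset.univ.filter fun p : Box lam μ => ¬ IsBarred L p ∧ L.1 p = k).card

/-- `ω(L^u_{<q})_k`: the number of `k`'s in the part of the unbarred column word that comes before
the box `q` is reached. -/
def contentBefore {d : ℕ} {lam μ : Partition d} (L : Filling lam μ) (q : Box lam μ)
    (k : Fin d) : ℕ :=
  (Finset.univ.filter fun p : Box lam μ => ¬ IsBarred L p ∧ L.1 p = k ∧ ReadBefore p q).card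

/-- The number of `k`'s in the part of the unbarred column word that has been written once the
box `q` has been read. -/
def contentUpTo {d : ℕ} {lam μ : Partition d} (L : Filling lam μ) (q : Box lam μ)
    (k : Fin d) : ℕ :=
  (Finset.univ.filter fun p : Box lam μ =>
    ¬ IsBarred L p ∧ L.1 p = k ∧ (ReadBefore p q ∨ p = q)).card

/-- The unbarred column word is Yamanouchi: at whatever box one stops reading, one has written at
least as many `k`'s as `(k + 1)`'s, for `k = 1, …, d - 1`. (The nonempty initial segments of the
word are those written when stopping at some box.) -/
def IsYamanouchi {d : ℕ} {lam μ : Partition d} (L : Filling lam μ) : Prop :=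
  ∀ (q : Box lam μ) (k k' : Fin d), k'.val = k.val + 1 → contentUpTo L q k' ≤ contentUpTo L q k

/-- The set of equivariant Littlewood-Richardson skew tableaux of shape `λ * μ` and unbarred
content `ν`. -/
def LR {d : ℕ} (lam μ ν : Partition d) : Finset (Filling lam μ) :=
  Finset.univ.filter fun L => IsSkewBarredTableau L ∧ IsYamanouchi L ∧ ∀ k, content L k = ν.1 k

/-- The factor `y_{|a|' + ω(L^u_{<a})_{|a|}} - y_{|a|' + c(a) - r(a)}` of `c_L` that belongs to
the entry `a` in the box `b` of `μ`. -/
def factor {d : ℕ} {lam μ : Partition d} (L : Filling lam μ) (b : Cell μ) : YRing :=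
  y (flip (L.1 (.inr b)) + contentBefore L (.inr b) (L.1 (.inr b)))
    - y (index (L.1 (.inr b)) b)

/-- `c_L`: the product of the factors belonging to the barred entries. -/
def coeff {d : ℕ} {lam μ : Partition d} (L : Filling lam μ) : YRing :=
  ∏ b ∈ L.2, factor L b

/-- `c_L > 0`: each factor of `c_L` is of the form `y_i - y_j` with `i > j`. -/
def CoeffPos {d : ℕ} {lam μ : Partition d} (L : Filling lam μ) : Prop :=
  ∀ b ∈ L.2, ∃ i j : ℕ+, j < i ∧ factor L b = MvPolynomial.X i - MvPolynomial.X j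

/-- The set of equivariant Littlewood-Richardson skew tableaux `L` of shape `λ * μ` and unbarred
content `ν` for which `c_L > 0`. -/
def LRPos {d : ℕ} (lam μ ν : Partition d) : Finset (Filling lam μ) :=
  (LR lam μ ν).filter CoeffPos

end

end EquivLR

namespace EquivLR

noncomputable section

open scoped Classical
open MvPolynomial

/-! Let a_{λ+ρ} be the antisymmetrization of the product of the falling powers (x_i | y)^{λ_i+ρ_i}.
As s_μ is symmetric (`rename_factorialSchur`), a_{λ+ρ} s_μ is the antisymmetrization of that product
times s_μ. Read the cells of a reverse tableau R in column order and split each factor x_a - y_j as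
(x_a - y_{n+1}) + (y_{n+1} - y_j), where n is the current exponent of x_a. The first summand raises
the exponent (unbarred entry), the second is a factor of c_L (barred entry). So a_{λ+ρ} s_μ becomes
a sum over pairs (R, B), with B the set of barred cells (`alternant_mul_factorialSchur_eq_sum`).

The pairs for which λ plus the content read so far stops being a partition cancel
(`sum_term_isFirstBad_eq_zero`). Group them by the first failing cell q, with entry k' = k + 1: the
exponents of x_k and x_{k'} after reading q are equal. Freeze everything up to q, sum over all bars
after q, and over all ways of exchanging k and k' in the later columns. The result is symmetric in
x_k and x_{k'}, so its antisymmetrization is 0. This symmetry (`rename_sum_swapClass`) holds only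
for sums over classes, since the factors depend on the positions; it rests on a telescoping identity
in each row, and also yields the symmetry of s_μ.

For λ = 0 only one surviving pair has nonzero weight, which gives a_ρ s_μ = a_{μ+ρ}. Cancelling a_ρ
turns the expansion of a_{λ+ρ} s_μ into one of s_λ s_μ; linear independence of the alternants gives
uniqueness. The Yamanouchi condition forces row k of λ to be filled with k, so the surviving pairs
are the tableaux L. Finally, a nonzero c_L has only factors y_i - y_j with i > j
(`index_lt_of_weight_ne_zero`), so requiring c_L > 0 discards only zeros. -/

/-! ### Antisymmetrization and falling monomials -/

/-- The antisymmetrizer `f ↦ ∑ σ, sgn σ • σ f`. -/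
def alt {d : ℕ} : MvPolynomial (Fin d) YRing →ₗ[YRing] MvPolynomial (Fin d) YRing :=
  ∑ σ : Equiv.Perm (Fin d), (Equiv.Perm.sign σ : ℤ) • (rename (R := YRing) σ).toLinearMap

theorem alt_apply {d : ℕ} (f : MvPolynomial (Fin d) YRing) :
    alt f = ∑ σ : Equiv.Perm (Fin d), (Equiv.Perm.sign σ : ℤ) • rename σ f := by
  simp [alt, LinearMap.sum_apply]

theorem alt_C_mul {d : ℕ} (a : YRing) (f : MvPolynomial (Fin d) YRing) :
    alt (C a * f) = C a * alt f := by
  rw [← smul_eq_C_mul, map_smul, smul_eq_C_mul]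

theorem alt_mul_of_symmetric {d : ℕ} (f g : MvPolynomial (Fin d) YRing)
    (hg : ∀ σ : Equiv.Perm (Fin d), rename σ g = g) : alt (f * g) = alt f * g := by
  rw [alt_apply, alt_apply, Finset.sum_mul]
  refine Finset.sum_congr rfl fun σ _ => ?_
  rw [map_mul, hg, smul_mul_assoc]

/-- Reindexing by σ ↦ σ ∘ (k k') reverses every sign and leaves the summands unchanged, so the sum
is its own negative; 2 is not a zero divisor. -/
theorem alt_eq_zero {d : ℕ} (f : MvPolynomial (Fin d) YRing) {k k' : Fin d} (hk : k ≠ k')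
    (hf : rename (Equiv.swap k k') f = f) : alt f = 0 := by
  have h : alt f = - alt f := by
    conv_lhs => rw [alt_apply, ← Equiv.sum_comp (Equiv.mulRight (Equiv.swap k k'))]
    rw [alt_apply, ← Finset.sum_neg_distrib]
    refine Finset.sum_congr rfl fun σ _ => ?_
    have h2 : rename (σ * Equiv.swap k k') f = rename σ f := by
      conv_rhs => rw [← hf]
      rw [rename_rename]; rfl
    rw [Equiv.coe_mulRight, h2]
    simp [Equiv.Perm.sign_mul, Equiv.Perm.sign_swap hk]
  exact self_eq_neg.mp h

/-- The falling power `(x_i | y)^n = (x_i - y_1) ⋯ (x_i - y_n)`. -/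
def fallingPow {d : ℕ} (n : ℕ) (i : Fin d) : MvPolynomial (Fin d) YRing :=
  ∏ j ∈ Finset.range n, (X i - C (y (j + 1)))

theorem fallingPow_succ {d : ℕ} (n : ℕ) (i : Fin d) :
    fallingPow (n + 1) i = fallingPow n i * (X i - C (y (n + 1))) :=
  Finset.prod_range_succ _ _

theorem rename_fallingPow {d : ℕ} (σ : Fin d → Fin d) (n : ℕ) (i : Fin d) :
    rename σ (fallingPow n i) = fallingPow n (σ i) := by
  simp [fallingPow, map_prod]

/-- The product of falling powers `∏ i, (x_i | y)^(α_i)`. -/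
def fallingMonomial {d : ℕ} (α : Fin d → ℕ) : MvPolynomial (Fin d) YRing :=
  ∏ i, fallingPow (α i) i

theorem rename_fallingMonomial {d : ℕ} (σ : Equiv.Perm (Fin d)) (α : Fin d → ℕ) :
    rename σ (fallingMonomial α) = fallingMonomial (α ∘ σ.symm) := by
  rw [fallingMonomial, map_prod, fallingMonomial,
    ← Equiv.prod_comp σ (fun i => fallingPow ((α ∘ σ.symm) i) i)]
  simp [rename_fallingPow]

theorem fallingMonomial_update_succ {d : ℕ} (α : Fin d → ℕ) (a : Fin d) :
    fallingMonomial (fun i => α i + if a = i then 1 else 0) =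
      fallingMonomial α * (X a - C (y (α a + 1))) := by
  have h : ∀ i, fallingPow (α i + if a = i then 1 else 0) i =
      fallingPow (α i) i * if a = i then (X a - C (y (α a + 1))) else 1 := by
    intro i
    split_ifs with h
    · subst h; exact fallingPow_succ _ _
    · simp
  simp only [fallingMonomial, h, Finset.prod_mul_distrib]
  simp

/-- Each falling power is monic with leading monomial x_i^n, and degrees of monic factors add up;
the lexicographic order is an arbitrary choice. -/
theorem fallingMonomial_degree_monic {d : ℕ} (α : Fin d → ℕ) :
    (fallingMonomial α).coeff (Finsupp.equivFunOnFinite.symm α) = 1 := by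
  let m : MonomialOrder (Fin d) := MonomialOrder.lex
  have h1 : ∀ i : Fin d, ∀ n, m.Monic (fallingPow n i) := fun i n =>
    MonomialOrder.Monic.prod fun j _ => m.monic_X_sub_C i _
  have h2 : ∀ i : Fin d, ∀ n, m.degree (fallingPow n i) = Finsupp.single i n := by
    intro i n
    induction n with
    | zero => simp [fallingPow]
    | succ n ih =>
      rw [fallingPow_succ, MonomialOrder.degree_mul_of_isRegular_right, ih,
        MonomialOrder.degree_X_sub_C, Finsupp.single_add]
      · exact (h1 i n).ne_zero
      · rw [MonomialOrder.monic_X_sub_C]; exact isRegular_one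
  have h3 : m.Monic (fallingMonomial α) := MonomialOrder.Monic.prod fun i _ => h1 i _
  have h4 : m.degree (fallingMonomial α) = Finsupp.equivFunOnFinite.symm α := by
    rw [fallingMonomial, MonomialOrder.degree_prod_of_regular]
    · simp only [h2]
      ext i
      simp [Finsupp.finsetSum_apply, Finsupp.single_apply]
    · intro i _
      rw [(h1 i (α i))]; exact isRegular_one
  rw [← h4]; exact h3

theorem le_of_coeff_fallingMonomial_ne_zero {d : ℕ} (α : Fin d → ℕ) (β : Fin d →₀ ℕ)
    (h : (fallingMonomial α).coeff β ≠ 0) (i : Fin d) : β i ≤ α i := by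
  have h0 : β i ≤ (fallingMonomial α).degreeOf i := by
    rw [degreeOf_eq_sup]
    exact Finset.le_sup (f := fun m : Fin d →₀ ℕ => m i) (mem_support_iff.mpr h)
  refine h0.trans ?_
  have hX : ∀ j n, degreeOf i (X j - C (y n) : MvPolynomial (Fin d) YRing)
      ≤ if j = i then 1 else 0 := by
    intro j n
    refine (degreeOf_sub_le _ _ _).trans ?_
    rw [degreeOf_C, degreeOf_X]
    simp [eq_comm]
  have hP : ∀ j n, degreeOf i (fallingPow n j : MvPolynomial (Fin d) YRing)
      ≤ if j = i then n else 0 := by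
    intro j n
    refine (degreeOf_prod_le _ _ _).trans ((Finset.sum_le_sum fun l _ => hX j (l + 1)).trans ?_)
    simp
  refine (degreeOf_prod_le _ _ _).trans ((Finset.sum_le_sum fun l _ => hP l (α l)).trans ?_)
  simp

/-! ### Alternants and their linear independence -/

/-- The staircase `ρ = (d - 1, …, 1, 0)`. -/
def rho {d : ℕ} (i : Fin d) : ℕ := d - 1 - i.val

/-- The alternant `a_{ν + ρ}(x | y)`. -/
def alternant {d : ℕ} (ν : Partition d) : MvPolynomial (Fin d) YRing :=
  alt (fallingMonomial fun i => ν.1 i + rho i)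

theorem strictAnti_add_rho {d : ℕ} (ν : Partition d) : StrictAnti fun i => ν.1 i + rho i := by
  intro i j h
  have := ν.2 h.le
  simp only [rho]
  have := j.isLt
  rw [Fin.lt_def] at h
  omega

theorem perm_eq_one_of_strictAnti {d : ℕ} {f g : Fin d → ℕ} (hf : StrictAnti f)
    (hg : StrictAnti g) (σ : Equiv.Perm (Fin d)) (h : f = g ∘ σ) : σ = 1 := by
  have hm : StrictMono σ := by
    intro i j hij
    have := hf hij
    rw [h] at this
    exact hg.lt_iff_gt.mp this
  have := Subsingleton.elim (StrictMono.orderIsoOfSurjective σ hm σ.surjective) (OrderIso.refl _)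
  ext i
  exact congrArg (fun e : Fin d ≃o Fin d => (e i).val) this

/-- If x^{ν+ρ} occurs in the summand of σ, then ν + ρ is bounded entrywise by the permuted κ + ρ.
The size hypothesis turns this into equality, and two strictly decreasing sequences can only be
permutations of each other by the identity. -/
theorem coeff_alternant {d : ℕ} (ν κ : Partition d) (hle : ∑ i, κ.1 i ≤ ∑ i, ν.1 i) :
    (alternant κ).coeff (Finsupp.equivFunOnFinite.symm fun i => ν.1 i + rho i) =
      if κ = ν then 1 else 0 := by
  have key : ∀ σ : Equiv.Perm (Fin d), (rename σ (fallingMonomial fun i => κ.1 i + rho i)).coeff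
      (Finsupp.equivFunOnFinite.symm fun i => ν.1 i + rho i) ≠ 0 → σ = 1 ∧ κ = ν := by
    intro σ h
    rw [rename_fallingMonomial] at h
    have h1 := le_of_coeff_fallingMonomial_ne_zero _ _ h
    simp only [Finsupp.equivFunOnFinite_symm_apply_apply, Function.comp] at h1
    have h2 : ∑ i, (κ.1 (σ.symm i) + rho (σ.symm i)) = ∑ i, (κ.1 i + rho i) :=
      Equiv.sum_comp σ.symm fun i => κ.1 i + rho i
    have h3 : ∑ i, (κ.1 i + rho i) ≤ ∑ i, (ν.1 i + rho i) := by
      rw [Finset.sum_add_distrib, Finset.sum_add_distrib]; omega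
    have h4 := (Finset.sum_eq_sum_iff_of_le (fun i _ => h1 i)).mp
      (le_antisymm (Finset.sum_le_sum fun i _ => h1 i) (h2.trans_le h3))
    have h5 : σ.symm = 1 := perm_eq_one_of_strictAnti (strictAnti_add_rho ν)
      (strictAnti_add_rho κ) σ.symm (funext fun i => h4 i (Finset.mem_univ _))
    refine ⟨inv_eq_one.mp h5, Subtype.ext (funext fun i => ?_)⟩
    have := h4 i (Finset.mem_univ _)
    rw [h5] at this
    simp at this
    exact this.symm
  have hc : (alternant κ).coeff (Finsupp.equivFunOnFinite.symm fun i => ν.1 i + rho i) =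
      ∑ σ : Equiv.Perm (Fin d), (Equiv.Perm.sign σ : ℤ) •
        (rename σ (fallingMonomial fun i => κ.1 i + rho i)).coeff
          (Finsupp.equivFunOnFinite.symm fun i => ν.1 i + rho i) := by
    rw [alternant, alt_apply, coeff_sum]
    rfl
  rw [hc, Finset.sum_eq_single 1]
  · split_ifs with h
    · subst h
      simpa using fallingMonomial_degree_monic fun i => κ.1 i + rho i
    · by_contra h2
      refine h (key 1 fun h3 => h2 ?_).2
      rw [h3, smul_zero]
  · intro σ _ hσ
    by_contra h2
    exact hσ (key σ fun h3 => h2 (by rw [h3, smul_zero])).1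
  · simp

/-- Unitriangularity: for ν of maximal size in the support, the coefficient of x^{ν+ρ} isolates the
coefficient at ν. -/
theorem eq_zero_of_sum_alternant {d : ℕ} (c : Partition d →₀ YRing)
    (h : (c.sum fun ν a => C a * alternant ν) = 0) : c = 0 := by
  by_contra hc
  obtain ⟨ν, hν, hmax⟩ := Finset.exists_max_image c.support (fun ν => ∑ i, ν.1 i)
    (Finsupp.support_nonempty_iff.mpr hc)
  have h1 := congrArg (MvPolynomial.coeff (Finsupp.equivFunOnFinite.symm fun i => ν.1 i + rho i)) h
  rw [Finsupp.sum, coeff_sum, Finset.sum_congr rfl (fun κ hκ => by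
    rw [coeff_C_mul, coeff_alternant ν κ (hmax κ hκ)])] at h1
  simp at h1
  exact (Finsupp.mem_support_iff.mp hν) h1

/-- The zero partition. -/
def zeroPartition (d : ℕ) : Partition d := ⟨fun _ => 0, fun _ _ _ => le_rfl⟩

theorem alternant_zero_ne_zero (d : ℕ) : alternant (zeroPartition d) ≠ 0 := by
  intro h
  have := coeff_alternant (zeroPartition d) (zeroPartition d) le_rfl
  rw [h] at this
  simp at this

/-! ### Expansion of linear factors into falling monomials -/

/-- Expansion of a product of linear factors in terms of falling monomials: at each element of `S`,
taken in the order given by `key`, the factor `x_a - t` is split as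
`(x_a - y_{α_a + 1}) + (y_{α_a + 1} - t)`. -/
theorem fallingMonomial_mul_prod {d : ℕ} {ι : Type*} [DecidableEq ι] (key : ι → ℕ)
    (hkey : Function.Injective key) (R : ι → Fin d) (t : ι → YRing) (α : Fin d → ℕ)
    (S : Finset ι) :
    fallingMonomial α * ∏ b ∈ S, (X (R b) - C (t b)) =
      ∑ B ∈ S.powerset,
        C (∏ b ∈ B, (y (α (R b) +
          ((S \ B).filter fun b' => R b' = R b ∧ key b' < key b).card + 1) - t b)) *
        fallingMonomial fun i => α i + ((S \ B).filter fun b' => R b' = i).card := by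
  -- Adding the last cell in the order leaves the counts for the earlier cells unchanged. Its two
  -- fates, in B or not, are the two summands of its linear factor.
  induction S using Finset.induction_on_max_value key with
  | empty => simp
  | insert q S hq hmax ih =>
    have hlt : ∀ b ∈ S, key b < key q := fun b hb =>
      lt_of_le_of_ne (hmax b hb) fun h => hq (hkey h ▸ hb)
    rw [Finset.prod_insert hq, mul_comm (X (R q) - C (t q)), ← mul_assoc, ih, Finset.sum_mul,
      Finset.sum_powerset_insert hq, ← Finset.sum_add_distrib]
    refine Finset.sum_congr rfl fun B hB => ?_
    have hBS := Finset.mem_powerset.mp hB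
    have hqB : q ∉ B := fun h => hq (hBS h)
    have e1 : insert q S \ B = insert q (S \ B) := Finset.insert_sdiff_of_notMem _ hqB
    have e2 : insert q S \ insert q B = S \ B := by
      rw [Finset.insert_sdiff_insert, Finset.sdiff_insert_of_notMem hq]
    have hqd : q ∉ S \ B := fun h => hq (Finset.mem_sdiff.mp h).1
    have e3 : ∀ b ∈ B, y (α (R b) +
        ((insert q (S \ B)).filter fun b' => R b' = R b ∧ key b' < key b).card + 1) - t b =
        y (α (R b) + ((S \ B).filter fun b' => R b' = R b ∧ key b' < key b).card + 1) - t b := by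
      intro b hb
      rw [Finset.filter_insert, if_neg fun h => absurd h.2 (hlt b (hBS hb)).not_gt]
    have e4 : ∀ i, ((insert q (S \ B)).filter fun b' => R b' = i).card =
        ((S \ B).filter fun b' => R b' = i).card + if R q = i then 1 else 0 := by
      intro i
      rw [Finset.filter_insert]
      split_ifs with h
      · rw [Finset.card_insert_of_notMem fun h' => hqd (Finset.mem_filter.mp h').1]
      · rfl
    have e5 : ((S \ B).filter fun b' => R b' = R q ∧ key b' < key q) =
        ((S \ B).filter fun b' => R b' = R q) := by
      refine Finset.filter_congr fun b hb => ?_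
      simp [hlt b (Finset.mem_sdiff.mp hb).1]
    rw [e1, e2, Finset.prod_insert hqB, e5]
    rw [Finset.prod_congr rfl e3]
    simp only [e4, ← add_assoc]
    rw [fallingMonomial_update_succ]
    simp only [map_mul, map_sub, map_prod]
    ring

/-! ### Symmetry of row sums -/

/-- Telescoping identity behind the symmetry of the row sums. -/
theorem sub_mul_sum_prod {A : Type*} [CommRing A] (z : ℕ → A) (u v : A) (lo hi : ℕ)
    (h : lo ≤ hi) :
    (v - u) * ∑ p ∈ Finset.Icc lo hi,
        ∏ i ∈ Finset.Ico lo hi, (if i < p then v - z i else u - z (i + 1)) =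
      ∏ i ∈ Finset.Icc lo hi, (v - z i) - ∏ i ∈ Finset.Icc lo hi, (u - z i) := by
  induction hi, h using Nat.le_induction with
  | base => simp
  | succ n hn ih =>
    have e1 : Finset.Icc lo (n + 1) = insert (n + 1) (Finset.Icc lo n) := by
      ext; simp; omega
    have e2 : Finset.Ico lo (n + 1) = insert n (Finset.Ico lo n) := by
      ext; simp; omega
    have e3 : ∀ p ∈ Finset.Icc lo n,
        (∏ i ∈ Finset.Ico lo (n + 1), (if i < p then v - z i else u - z (i + 1))) =
        (u - z (n + 1)) * ∏ i ∈ Finset.Ico lo n, (if i < p then v - z i else u - z (i + 1)) := by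
      intro p hp
      rw [e2, Finset.prod_insert (by simp), if_neg (by simp at hp; omega)]
    have e4 : (∏ i ∈ Finset.Ico lo (n + 1), (if i < n + 1 then v - z i else u - z (i + 1))) =
        ∏ i ∈ Finset.Icc lo n, (v - z i) := by
      refine Finset.prod_congr (by ext; simp) fun i hi => if_pos ?_
      simp at hi; omega
    rw [e1, Finset.sum_insert (by simp), Finset.prod_insert (by simp),
      Finset.prod_insert (by simp), e4, Finset.sum_congr rfl e3, ← Finset.mul_sum, mul_add,
      mul_left_comm, ih]
    ring

/-- The right-hand side of `sub_mul_sum_prod` and the factor v - u both change sign when u and v are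
exchanged, and v - u can be cancelled in a domain. -/
theorem sum_prod_threshold_symm {A : Type*} [CommRing A] [IsDomain A] (z : ℕ → A) (u v : A)
    (lo hi : ℕ) (h : lo ≤ hi) :
    (∑ p ∈ Finset.Icc lo hi,
        ∏ i ∈ Finset.Ico lo hi, (if i < p then v - z i else u - z (i + 1))) =
      ∑ p ∈ Finset.Icc lo hi,
        ∏ i ∈ Finset.Ico lo hi, (if i < p then u - z i else v - z (i + 1)) := by
  by_cases huv : v = u
  · subst huv; rfl
  · refine mul_left_cancel₀ (sub_ne_zero.mpr huv) ?_
    rw [sub_mul_sum_prod z u v lo hi h, ← neg_sub u v, neg_mul, sub_mul_sum_prod z v u lo hi h]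
    ring

/-- The rows obtained from the row `g` by changing the entries at the places in `F` to arbitrary
elements of `{k, k'}`. -/
def rowClass {d n : ℕ} (g : Fin n → Fin d) (F : Finset (Fin n)) (k k' : Fin d) :
    Finset (Fin n → Fin d) :=
  Finset.univ.filter fun f => Antitone f ∧ (∀ c, c ∉ F → f c = g c) ∧
    ∀ c ∈ F, f c = k ∨ f c = k'

theorem exists_interval {n : ℕ} (F : Finset (Fin n))
    (hF : ∀ a ∈ F, ∀ b ∈ F, ∀ c, a < c → c < b → c ∈ F) :
    ∃ lo hi, lo ≤ hi ∧ hi ≤ n ∧ ∀ c : Fin n, c ∈ F ↔ lo ≤ c.val ∧ c.val < hi := by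
  rcases F.eq_empty_or_nonempty with rfl | hne
  · exact ⟨0, 0, le_rfl, Nat.zero_le _, by simp⟩
  · have hmm : F.min' hne ≤ F.max' hne := F.min'_le _ (F.max'_mem hne)
    refine ⟨(F.min' hne).val, (F.max' hne).val + 1, ?_, (F.max' hne).isLt, fun c => ?_⟩
    · rw [Fin.le_def] at hmm; omega
    · constructor
      · intro hc
        have h1 := F.min'_le c hc
        have h2 := F.le_max' c hc
        rw [Fin.le_def] at h1 h2
        omega
      · rintro ⟨h1, h2⟩
        by_cases e1 : c = F.min' hne
        · exact e1 ▸ F.min'_mem hne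
        by_cases e2 : c = F.max' hne
        · exact e2 ▸ F.max'_mem hne
        refine hF _ (F.min'_mem hne) _ (F.max'_mem hne) c ?_ ?_
        · exact lt_of_le_of_ne h1 (Ne.symm e1)
        · exact lt_of_le_of_ne (Nat.lt_succ_iff.mp h2) e2

/-- A row of the class is determined by a threshold p: places of F before p hold k', the others k,
because rows decrease weakly in the column number. By `hl` and `hr` the fixed entries put no
constraint on p. -/
theorem sum_rowClass {d n : ℕ} {A : Type*} [CommRing A] (g : Fin n → Fin d) (hg : Antitone g)
    (F : Finset (Fin n)) {k k' : Fin d} (hk : k < k')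
    (hl : ∀ c, c ∉ F → ∀ c' ∈ F, c < c' → k' ≤ g c)
    (hr : ∀ c, c ∉ F → ∀ c' ∈ F, c' < c → g c ≤ k)
    (lo hi : ℕ) (hlh : lo ≤ hi) (hhn : hi ≤ n)
    (hF : ∀ c : Fin n, c ∈ F ↔ lo ≤ c.val ∧ c.val < hi) (w w' : ℕ → A) :
    (∑ f ∈ rowClass g F k k', ∏ c ∈ F, (if f c = k then w c.val else w' c.val)) =
      ∑ p ∈ Finset.Icc lo hi, ∏ i ∈ Finset.Ico lo hi, (if i < p then w' i else w i) := by
  symm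
  refine Finset.sum_bij
    (fun p _ c => if c ∈ F then (if c.val < p then k' else k) else g c) ?_ ?_ ?_ ?_
  · intro p hp
    simp only [rowClass, Finset.mem_filter, Finset.mem_univ, true_and]
    refine ⟨fun a b hab => ?_, fun c hc => if_neg hc, fun c hc => ?_⟩
    · by_cases ha : a ∈ F <;> by_cases hb : b ∈ F
      · simp only [ha, hb, if_true]
        rw [Fin.le_def] at hab
        split_ifs
        · exact le_rfl
        · omega
        · exact hk.le
        · exact le_rfl
      · have hab' : a < b := lt_of_le_of_ne hab fun h => hb (h ▸ ha)
        have := hr b hb a ha hab'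
        simp only [ha, hb, if_true, if_false]
        split_ifs
        · exact this.trans hk.le
        · exact this
      · have hab' : a < b := lt_of_le_of_ne hab fun h => ha (h ▸ hb)
        have := hl a ha b hb hab'
        simp only [ha, hb, if_true, if_false]
        split_ifs
        · exact this
        · exact hk.le.trans this
      · simp only [ha, hb, if_false]
        exact hg hab
    · simp only [hc, if_true]
      split_ifs
      · exact Or.inr rfl
      · exact Or.inl rfl
  · intro p hp q hq h
    simp only [Finset.mem_Icc] at hp hq
    by_contra hne
    have key : ∀ p q : ℕ, p < q → lo ≤ p → q ≤ hi →
        (fun c : Fin n => if c ∈ F then (if c.val < p then k' else k) else g c) ≠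
        (fun c : Fin n => if c ∈ F then (if c.val < q then k' else k) else g c) := by
      intro p q hpq hp hq h
      have h1 := congrFun h ⟨p, by omega⟩
      have h2 : (⟨p, by omega⟩ : Fin n) ∈ F := (hF _).mpr ⟨hp, by simp; omega⟩
      simp only [h2, if_true, lt_irrefl, if_false, hpq] at h1
      exact hk.ne h1
    rcases lt_or_gt_of_ne hne with h1 | h1
    · exact key p q h1 hp.1 hq.2 h
    · exact key q p h1 hq.1 hp.2 h.symm
  · intro f hf
    simp only [rowClass, Finset.mem_filter, Finset.mem_univ, true_and] at hf
    obtain ⟨hf1, hf2, hf3⟩ := hf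
    -- The threshold of f is the least p ≥ lo from which on all places of F hold k.
    have hex : ∃ p, lo ≤ p ∧ ∀ c : Fin n, c ∈ F → p ≤ c.val → f c = k :=
      ⟨hi, hlh, fun c hc h => absurd ((hF c).mp hc).2 (by omega)⟩
    have hp1 := Nat.find_spec hex
    have hp2 : ∀ c : Fin n, c ∈ F → c.val < Nat.find hex → f c = k' := by
      intro c hc hlt
      refine (hf3 c hc).resolve_left fun hfc => Nat.find_min hex hlt ⟨((hF c).mp hc).1, ?_⟩
      intro c' hc' hle
      refine (hf3 c' hc').resolve_right fun h => ?_
      have := hf1 (show c ≤ c' from hle)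
      rw [hfc, h] at this
      exact absurd hk this.not_gt
    refine ⟨Nat.find hex, Finset.mem_Icc.mpr ⟨hp1.1, Nat.find_min' hex
      ⟨hlh, fun c hc h => absurd ((hF c).mp hc).2 (by omega)⟩⟩, funext fun c => ?_⟩
    by_cases hc : c ∈ F
    · simp only [hc, if_true]
      split_ifs with h
      · exact (hp2 c hc h).symm
      · exact (hp1.2 c hc (not_lt.mp h)).symm
    · simp only [hc, if_false]
      exact (hf2 c hc).symm
  · intro p hp
    symm
    refine Finset.prod_bij (fun c _ => c.val) ?_ ?_ ?_ ?_
    · intro c hc; exact Finset.mem_Ico.mpr ((hF c).mp hc)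
    · intro a _ b _ h; exact Fin.ext h
    · intro i hi'
      have := Finset.mem_Ico.mp hi'
      exact ⟨⟨i, by omega⟩, (hF _).mpr this, rfl⟩
    · intro c hc
      simp only [hc, if_true]
      by_cases h : c.val < p
      · simp [h, hk.ne']
      · simp [h]

/-! ### Exchanging adjacent entries k and k' in a reverse tableau -/

theorem IsReverseTableau.row_le {d : ℕ} {μ : Partition d} {R : Cell μ → Fin d}
    (hR : IsReverseTableau R) {b b' : Cell μ} (h1 : b.1 = b'.1) (h2 : b'.2.val ≤ b.2.val) :
    R b ≤ R b' :=
  hR.1 b b' (by simp [Cell.row, h1]) (by simp [Cell.col, h2])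

theorem IsReverseTableau.col_lt {d : ℕ} {μ : Partition d} {R : Cell μ → Fin d}
    (hR : IsReverseTableau R) {b b' : Cell μ} (h1 : b.2.val = b'.2.val) (h2 : b'.1 < b.1) :
    R b < R b' :=
  hR.2 b b' (by simp [Cell.col, h1]) (by simpa [Cell.row] using h2)

theorem Cell.ext' {d : ℕ} {μ : Partition d} {b b' : Cell μ} (h1 : b.1 = b'.1)
    (h2 : b.2.val = b'.2.val) : b = b' := by
  obtain ⟨r, c⟩ := b
  obtain ⟨r', c'⟩ := b'
  obtain rfl : r = r' := h1
  obtain rfl : c = c' := Fin.ext h2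
  rfl

theorem IsReverseTableau.eq_of_col_eq {d : ℕ} {μ : Partition d} {R : Cell μ → Fin d}
    (hR : IsReverseTableau R) {b b' : Cell μ} (h1 : b.2.val = b'.2.val) (h2 : R b = R b') :
    b = b' := by
  rcases lt_trichotomy b.1 b'.1 with h | h | h
  · exact absurd h2 (hR.col_lt h1.symm h).ne'
  · exact Cell.ext' h h1
  · exact absurd h2 (hR.col_lt h1 h).ne

theorem IsReverseTableau.row_lt_of_lt {d : ℕ} {μ : Partition d} {R : Cell μ → Fin d}
    (hR : IsReverseTableau R) {b b' : Cell μ} (h1 : b.2.val = b'.2.val) (h2 : R b < R b') :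
    b'.1 < b.1 := by
  by_contra h
  rcases (not_lt.mp h).lt_or_eq with h | h
  · exact absurd h2 (hR.col_lt h1.symm h).not_gt
  · exact absurd h2 (by rw [Cell.ext' h h1]; exact lt_irrefl _)

/-- The cells in the columns after the first `j` ones with entry `k` or `k'`. -/
def Swappable {d : ℕ} {μ : Partition d} (R : Cell μ → Fin d) (k k' : Fin d) (j : ℕ)
    (b : Cell μ) : Prop :=
  j ≤ b.2.val ∧ (R b = k ∨ R b = k')

/-- The cells with entry `k` or `k'` that are the only ones with such an entry in their column. -/
def IsFree {d : ℕ} {μ : Partition d} (R : Cell μ → Fin d) (k k' : Fin d) (j : ℕ)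
    (b : Cell μ) : Prop :=
  Swappable R k k' j b ∧ ∀ b', Swappable R k k' j b' → b'.2.val = b.2.val → b' = b

/-- The reverse tableaux obtained from `R` by exchanging some entries `k` and `k'` in the columns
after the first `j` ones. -/
def swapClass {d : ℕ} {μ : Partition d} (R : Cell μ → Fin d) (k k' : Fin d) (j : ℕ) :
    Finset (Cell μ → Fin d) :=
  Finset.univ.filter fun R' => IsReverseTableau R' ∧
    (∀ b, ¬ Swappable R k k' j b → R' b = R b) ∧
    ∀ b, Swappable R k k' j b → R' b = k ∨ R' b = k'

section
variable {d : ℕ} {μ : Partition d} {R : Cell μ → Fin d} {k k' : Fin d} {j : ℕ}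

/-- Otherwise both cells hold k. Some column between them has a k' in a lower row: the partner of
the first cell, or, if that cell lies in the frozen columns, the one that `H` provides in the last
of these. Monotonicity then forces a k' into the same lower row of the column of the free cell,
which is thus not free. -/
theorem le_of_left_of_isFree (hR : IsReverseTableau R) (hk : k'.val = k.val + 1)
    (H : ∀ b : Cell μ, b.2.val + 1 = j → R b = k → ∃ b' : Cell μ, b'.2.val = b.2.val ∧ R b' = k')
    {r : Fin d} {c c' : Fin (μ.1 r)} (hc : ¬ IsFree R k k' j ⟨r, c⟩)
    (hc' : IsFree R k k' j ⟨r, c'⟩) (hcc : c < c') : k' ≤ R ⟨r, c⟩ := by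
  by_contra hlt
  have h1 : R ⟨r, c'⟩ ≤ R ⟨r, c⟩ := hR.row_le rfl hcc.le
  have h2 : R ⟨r, c⟩ = k ∧ R ⟨r, c'⟩ = k := by
    have := hc'.1.2
    constructor <;> ext <;> rcases this with h | h <;> rw [h] at h1 <;>
      simp only [Fin.lt_def, Fin.le_def, not_le, h] at * <;> omega
  have h3 : ∃ a : Cell μ, c.val ≤ a.2.val ∧ a.2.val ≤ c'.val ∧ R a = k' ∧ a.1 < r := by
    by_cases hj : j ≤ c.val
    · have hV : Swappable R k k' j ⟨r, c⟩ := ⟨hj, Or.inl h2.1⟩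
      have : ∃ a, Swappable R k k' j a ∧ a.2.val = c.val ∧ a ≠ ⟨r, c⟩ := by
        by_contra hcon
        push Not at hcon
        exact hc ⟨hV, hcon⟩
      obtain ⟨a, ha, hac, hne⟩ := this
      have hak : R a = k' := ha.2.resolve_left fun h =>
        hne (hR.eq_of_col_eq hac (h.trans h2.1.symm))
      refine ⟨a, hac.ge, hac.le.trans hcc.le, hak, ?_⟩
      refine hR.row_lt_of_lt (b := ⟨r, c⟩) hac.symm ?_
      rw [h2.1, hak, Fin.lt_def]; omega
    · have hj' : j ≤ c'.val := hc'.1.1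
      have hb : j - 1 < μ.1 r := by omega
      have hk1 : R ⟨r, ⟨j - 1, hb⟩⟩ = k := by
        refine le_antisymm ?_ ?_
        · rw [← h2.1]; exact hR.row_le rfl (by simp; omega)
        · rw [← h2.2]; exact hR.row_le rfl (by simp; omega)
      obtain ⟨a, hac, hak⟩ := H _ (by simp; omega) hk1
      simp only at hac
      refine ⟨a, by omega, by omega, hak, ?_⟩
      refine hR.row_lt_of_lt (b := ⟨r, ⟨j - 1, hb⟩⟩) hac.symm ?_
      rw [hk1, hak, Fin.lt_def]; omega
  obtain ⟨a, ha1, ha2, hak, har⟩ := h3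
  let b : Cell μ := ⟨a.1, ⟨c'.val, c'.isLt.trans_le (μ.2 har.le)⟩⟩
  have e1 : R b ≤ R a := hR.row_le rfl ha2
  have e2 : R ⟨r, c'⟩ < R b := hR.col_lt rfl har
  have e3 : R b = k' := by
    rw [hak] at e1
    rw [h2.2] at e2
    ext
    rw [Fin.le_def] at e1
    rw [Fin.lt_def] at e2
    omega
  have e4 := hc'.2 b ⟨hc'.1.1, Or.inr e3⟩ rfl
  exact har.ne (congrArg Sigma.fst e4)

/-- Mirror image of `le_of_left_of_isFree`, with a partner k in a higher row. All columns involved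
are past the frozen ones, so no analogue of `H` is needed. -/
theorem le_of_right_of_isFree (hR : IsReverseTableau R) (hk : k'.val = k.val + 1)
    {r : Fin d} {c c' : Fin (μ.1 r)} (hc : ¬ IsFree R k k' j ⟨r, c⟩)
    (hc' : IsFree R k k' j ⟨r, c'⟩) (hcc : c' < c) : R ⟨r, c⟩ ≤ k := by
  by_contra hlt
  have h1 : R ⟨r, c⟩ ≤ R ⟨r, c'⟩ := hR.row_le rfl hcc.le
  have h2 : R ⟨r, c⟩ = k' ∧ R ⟨r, c'⟩ = k' := by
    have := hc'.1.2
    constructor <;> ext <;> rcases this with h | h <;> rw [h] at h1 <;>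
      simp only [Fin.lt_def, Fin.le_def, not_le, h] at * <;> omega
  have hV : Swappable R k k' j ⟨r, c⟩ := ⟨hc'.1.1.trans hcc.le, Or.inr h2.1⟩
  have : ∃ a, Swappable R k k' j a ∧ a.2.val = c.val ∧ a ≠ ⟨r, c⟩ := by
    by_contra hcon
    push Not at hcon
    exact hc ⟨hV, hcon⟩
  obtain ⟨a, ha, hac, hne⟩ := this
  have hak : R a = k := ha.2.resolve_right fun h =>
    hne (hR.eq_of_col_eq hac (h.trans h2.1.symm))
  have har : r < a.1 := by
    refine hR.row_lt_of_lt (b' := ⟨r, c⟩) hac ?_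
    rw [h2.1, hak, Fin.lt_def]; omega
  have hlt : c'.val < a.2.val := by rw [hac]; exact hcc
  let b : Cell μ := ⟨a.1, ⟨c'.val, hlt.trans a.2.isLt⟩⟩
  have e1 : R a ≤ R b := hR.row_le rfl hlt.le
  have e2 : R b < R ⟨r, c'⟩ := hR.col_lt rfl har
  have e3 : R b = k := by
    rw [hak] at e1
    rw [h2.2] at e2
    ext
    rw [Fin.le_def] at e1
    rw [Fin.lt_def] at e2
    omega
  have e4 := hc'.2 b ⟨hc'.1.1, Or.inl e3⟩ rfl
  exact har.ne' (congrArg Sigma.fst e4)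

/-- The free places in row `r`. -/
def freeRow (R : Cell μ → Fin d) (k k' : Fin d) (j : ℕ) (r : Fin d) : Finset (Fin (μ.1 r)) :=
  Finset.univ.filter fun c => IsFree R k k' j ⟨r, c⟩

/-- In a column with both k and k', strictness determines where each goes, so only free cells can
change. Changing them never breaks a column, since every other entry compares in the same way with k
and with k' = k + 1. Hence the rows vary independently. -/
theorem mem_swapClass_iff (hR : IsReverseTableau R) (hk : k'.val = k.val + 1)
    (R' : Cell μ → Fin d) :
    R' ∈ swapClass R k k' j ↔
      ∀ r, (fun c => R' ⟨r, c⟩) ∈ rowClass (fun c => R ⟨r, c⟩) (freeRow R k k' j r) k k' := by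
  simp only [swapClass, rowClass, freeRow, Finset.mem_filter, Finset.mem_univ, true_and]
  constructor
  · rintro ⟨h1, h2, h3⟩ r
    refine ⟨fun a b hab => h1.row_le rfl hab, fun c hc => ?_, fun c hc => h3 _ hc.1⟩
    by_cases hV : Swappable R k k' j ⟨r, c⟩
    · have : ∃ a, Swappable R k k' j a ∧ a.2.val = c.val ∧ a ≠ ⟨r, c⟩ := by
        by_contra hcon
        push Not at hcon
        exact hc ⟨hV, hcon⟩
      obtain ⟨a, ha, hac, hne⟩ := this
      have key : ∀ Q : Cell μ → Fin d, IsReverseTableau Q → (Q a = k ∨ Q a = k') →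
          (Q ⟨r, c⟩ = k ∨ Q ⟨r, c⟩ = k') → Q ⟨r, c⟩ = if a.1 < r then k else k' := by
        intro Q hQ h4 h5
        rcases lt_trichotomy a.1 r with h | h | h
        · have := hQ.col_lt (b := ⟨r, c⟩) hac.symm h
          rw [if_pos h]
          refine h5.resolve_right fun h6 => ?_
          rw [h6, Fin.lt_def] at this
          rcases h4 with h4 | h4 <;> rw [h4] at this <;> omega
        · exact absurd (Cell.ext' h hac) hne
        · have := hQ.col_lt (b' := ⟨r, c⟩) hac h
          rw [if_neg h.not_gt]
          refine h5.resolve_left fun h6 => ?_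
          rw [h6, Fin.lt_def] at this
          rcases h4 with h4 | h4 <;> rw [h4] at this <;> omega
      rw [key R' h1 (h3 a ha) (h3 _ hV), key R hR ha.2 hV.2]
    · exact h2 _ hV
  · intro h
    have hnf : ∀ b, ¬ IsFree R k k' j b → R' b = R b := fun b hb => (h b.1).2.1 b.2 hb
    have hf : ∀ b, IsFree R k k' j b → R' b = k ∨ R' b = k' := fun b hb => (h b.1).2.2 b.2 hb
    refine ⟨⟨fun b b' h1 h2 => ?_, fun b b' h1 h2 => ?_⟩, fun b hb => hnf b fun h => hb h.1,
      fun b hb => ?_⟩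
    · obtain ⟨r, c⟩ := b
      obtain ⟨r', c'⟩ := b'
      obtain rfl : r = r' := by simp [Cell.row] at h1; exact Fin.ext h1
      exact (h r).1 (by simpa [Cell.col] using h2)
    · have h1' : b.2.val = b'.2.val := by simpa [Cell.col] using h1
      have h2' : b'.1 < b.1 := by simpa [Cell.row] using h2
      have hlt := hR.col_lt h1' h2'
      have hne : b' ≠ b := fun e => h2'.ne (congrArg Sigma.fst e)
      by_cases hb : IsFree R k k' j b
      · have hV : ¬ Swappable R k k' j b' := fun e => hne (hb.2 b' e h1'.symm)
        rw [hnf b' fun e => hV e.1]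
        have h4 : ¬ (R b' = k ∨ R b' = k') := fun e => hV ⟨h1' ▸ hb.1.1, e⟩
        have h5 := hf b hb
        have h6 := hb.1.2
        rw [Fin.lt_def] at hlt ⊢
        simp only [Fin.ext_iff] at h4 h5 h6
        omega
      · rw [hnf b hb]
        by_cases hb' : IsFree R k k' j b'
        · have hV : ¬ Swappable R k k' j b := fun e => hne.symm (hb'.2 b e h1')
          have h4 : ¬ (R b = k ∨ R b = k') := fun e => hV ⟨h1' ▸ hb'.1.1, e⟩
          have h5 := hf b' hb'
          have h6 := hb'.1.2
          rw [Fin.lt_def] at hlt ⊢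
          simp only [Fin.ext_iff] at h4 h5 h6
          omega
        · rw [hnf b' hb']; exact hlt
    · by_cases hfb : IsFree R k k' j b
      · exact hf b hfb
      · rw [hnf b hfb]; exact hb.2

/-- The linear factor belonging to the entry `a` in the cell `b`. -/
def linFactor (a : Fin d) (b : Cell μ) : MvPolynomial (Fin d) YRing :=
  X a - C (y (index a b))

theorem rename_linFactor (σ : Fin d → Fin d) (a : Fin d) (b : Cell μ) :
    rename σ (linFactor a b) = X (σ a) - C (y (index a b)) := by
  simp [linFactor]

theorem flip_eq_succ (hk : k'.val = k.val + 1) : flip k = flip k' + 1 := by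
  have := k'.isLt
  simp only [flip]; omega

theorem rename_sum_rowClass (hR : IsReverseTableau R) (hk : k'.val = k.val + 1)
    (H : ∀ b : Cell μ, b.2.val + 1 = j → R b = k → ∃ b' : Cell μ, b'.2.val = b.2.val ∧ R b' = k')
    (r : Fin d) :
    rename (Equiv.swap k k') (∑ f ∈ rowClass (fun c => R ⟨r, c⟩) (freeRow R k k' j r) k k',
        ∏ c ∈ freeRow R k k' j r, linFactor (f c) (⟨r, c⟩ : Cell μ)) =
      ∑ f ∈ rowClass (fun c => R ⟨r, c⟩) (freeRow R k k' j r) k k',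
        ∏ c ∈ freeRow R k k' j r, linFactor (f c) (⟨r, c⟩ : Cell μ) := by
  have hlt : k < k' := by rw [Fin.lt_def]; omega
  have hmem : ∀ c, c ∈ freeRow R k k' j r ↔ IsFree R k k' j ⟨r, c⟩ := by simp [freeRow]
  have hl : ∀ c, c ∉ freeRow R k k' j r → ∀ c' ∈ freeRow R k k' j r, c < c' →
      k' ≤ R ⟨r, c⟩ := fun c hc c' hc' h =>
    le_of_left_of_isFree hR hk H (fun e => hc ((hmem c).mpr e)) ((hmem c').mp hc') h
  have hr : ∀ c, c ∉ freeRow R k k' j r → ∀ c' ∈ freeRow R k k' j r, c' < c →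
      R ⟨r, c⟩ ≤ k := fun c hc c' hc' h =>
    le_of_right_of_isFree hR hk (fun e => hc ((hmem c).mpr e)) ((hmem c').mp hc') h
  obtain ⟨lo, hi, h1, h2, h3⟩ := exists_interval (freeRow R k k' j r) (by
    intro a ha b hb c hac hcb
    by_contra hc
    exact absurd hlt ((hl c hc b hb hcb).trans (hr c hc a ha hac)).not_gt)
  have hg : Antitone fun c : Fin (μ.1 r) => R ⟨r, c⟩ := fun a b hab => hR.row_le rfl hab
  -- As flip k = flip k' + 1, an entry k in a column has the parameter that k' would have one column
  -- further on. This is the shift in `sum_prod_threshold_symm`.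
  let z : ℕ → MvPolynomial (Fin d) YRing := fun n => C (y (flip k' + (n + 1) - (r.val + 1)))
  have hfac : ∀ f ∈ rowClass (fun c => R ⟨r, c⟩) (freeRow R k k' j r) k k',
      ∀ c ∈ freeRow R k k' j r, linFactor (f c) (⟨r, c⟩ : Cell μ) =
        if f c = k then X k - z (c.val + 1) else X k' - z c.val := by
    intro f hf c hc
    simp only [rowClass, Finset.mem_filter, Finset.mem_univ, true_and] at hf
    rcases hf.2.2 c hc with h | h
    · rw [h, if_pos rfl, linFactor, index, flip_eq_succ hk]
      simp only [z, Cell.row, Cell.col]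
      congr 4
      omega
    · rw [h, if_neg hlt.ne']; rfl
  have hfac' : ∀ f ∈ rowClass (fun c => R ⟨r, c⟩) (freeRow R k k' j r) k k',
      ∀ c ∈ freeRow R k k' j r, rename (Equiv.swap k k') (linFactor (f c) (⟨r, c⟩ : Cell μ)) =
        if f c = k then X k' - z (c.val + 1) else X k - z c.val := by
    intro f hf c hc
    rw [hfac f hf c hc]
    split_ifs <;> simp [z]
  have hs := sum_rowClass (A := MvPolynomial (Fin d) YRing) (fun c => R ⟨r, c⟩) hg
    (freeRow R k k' j r) hlt hl hr lo hi h1 h2 h3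
  rw [map_sum]
  simp only [map_prod]
  rw [Finset.sum_congr rfl fun f hf => Finset.prod_congr rfl (hfac' f hf),
    Finset.sum_congr rfl fun f hf => Finset.prod_congr rfl (hfac f hf),
    hs (fun n => X k' - z (n + 1)) (fun n => X k - z n),
    hs (fun n => X k - z (n + 1)) (fun n => X k' - z n)]
  exact sum_prod_threshold_symm z _ _ lo hi h1

theorem sum_swapClass_free (hR : IsReverseTableau R) (hk : k'.val = k.val + 1) :
    (∑ R' ∈ swapClass R k k' j, ∏ b with IsFree R k k' j b, linFactor (R' b) b) =
      ∏ r, ∑ f ∈ rowClass (fun c => R ⟨r, c⟩) (freeRow R k k' j r) k k',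
        ∏ c ∈ freeRow R k k' j r, linFactor (f c) (⟨r, c⟩ : Cell μ) := by
  rw [Finset.prod_univ_sum]
  refine Finset.sum_bij (fun R' _ r c => R' ⟨r, c⟩) ?_ ?_ ?_ ?_
  · intro R' hR'
    exact Fintype.mem_piFinset.mpr ((mem_swapClass_iff hR hk R').mp hR')
  · intro R1 _ R2 _ h
    funext b
    exact congrFun (congrFun h b.1) b.2
  · intro p hp
    exact ⟨fun b => p b.1 b.2,
      (mem_swapClass_iff hR hk _).mpr fun r => Fintype.mem_piFinset.mp hp r, rfl⟩
  · intro R' _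
    rw [Finset.prod_sigma' Finset.univ (fun r => freeRow R k k' j r)
      (fun r c => linFactor (R' ⟨r, c⟩) (⟨r, c⟩ : Cell μ))]
    refine Finset.prod_congr ?_ fun _ _ => rfl
    ext b
    simp [freeRow]

/-- The entry k sits directly above k', so passing from k' to k raises both flip and the row number
by one. Hence the two factors of a pair form a product symmetric in x_k and x_{k'}. -/
theorem index_eq_of_pair (hR : IsReverseTableau R) (hk : k'.val = k.val + 1) {b b' : Cell μ}
    (h1 : b.2.val = b'.2.val) (hb : R b = k) (hb' : R b' = k') : index k b = index k' b' := by
  have hlt : b'.1 < b.1 := hR.row_lt_of_lt h1 (by rw [hb, hb', Fin.lt_def]; omega)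
  have hadj : b.1.val = b'.1.val + 1 := by
    by_contra hne
    rw [Fin.lt_def] at hlt
    have hm : b'.1.val + 1 < d := by omega
    have hle : (⟨b'.1.val + 1, hm⟩ : Fin d) ≤ b.1 := by rw [Fin.le_def]; simp; omega
    let a : Cell μ := ⟨⟨b'.1.val + 1, hm⟩, ⟨b.2.val, b.2.isLt.trans_le (μ.2 hle)⟩⟩
    have e1 : R b < R a := hR.col_lt rfl (by rw [Fin.lt_def]; simp [a]; omega)
    have e2 : R a < R b' := hR.col_lt h1 (by rw [Fin.lt_def]; simp [a])
    rw [hb, Fin.lt_def] at e1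
    rw [hb', Fin.lt_def] at e2
    omega
  rw [index, index, flip_eq_succ hk]
  simp only [Cell.row, Cell.col]
  omega

theorem rename_prod_paired (hR : IsReverseTableau R) (hk : k'.val = k.val + 1) :
    rename (Equiv.swap k k')
        (∏ b with Swappable R k k' j b ∧ ¬ IsFree R k k' j b, linFactor (R b) b) =
      ∏ b with Swappable R k k' j b ∧ ¬ IsFree R k k' j b, linFactor (R b) b := by
  have hkk : k ≠ k' := fun h => by rw [h] at hk; omega
  have hex : ∀ b : Cell μ, Swappable R k k' j b ∧ ¬ IsFree R k k' j b →
      ∃ a, Swappable R k k' j a ∧ a.2.val = b.2.val ∧ a ≠ b := by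
    intro b hb
    by_contra hcon
    push Not at hcon
    exact hb.2 ⟨hb.1, hcon⟩
  let S : Finset (Cell μ) :=
    Finset.univ.filter fun b => Swappable R k k' j b ∧ ¬ IsFree R k k' j b
  have hS : ∀ b, b ∈ S ↔ Swappable R k k' j b ∧ ¬ IsFree R k k' j b := by simp [S]
  -- p sends a paired cell to its partner in the column; reindexing by this involution undoes the
  -- exchange of variables.
  choose! p hp using hex
  have hpS : ∀ b ∈ S, p b ∈ S := fun b hb => by
    have := hp b ((hS b).mp hb)
    refine (hS _).mpr ⟨this.1, fun hf => this.2.2 ?_⟩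
    exact (hf.2 b ((hS b).mp hb).1 this.2.1.symm).symm
  have hval : ∀ b ∈ S, R (p b) = Equiv.swap k k' (R b) := by
    intro b hb
    have h1 := hp b ((hS b).mp hb)
    have hne : R (p b) ≠ R b := fun h => h1.2.2 (hR.eq_of_col_eq h1.2.1 h)
    rcases ((hS b).mp hb).1.2 with h | h <;> rcases h1.1.2 with h' | h'
    · exact absurd (h'.trans h.symm) hne
    · rw [h, h', Equiv.swap_apply_left]
    · rw [h, h', Equiv.swap_apply_right]
    · exact absurd (h'.trans h.symm) hne
  have hpp : ∀ b ∈ S, p (p b) = b := by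
    intro b hb
    have h1 := hp b ((hS b).mp hb)
    have h2 := hp (p b) ((hS _).mp (hpS b hb))
    refine hR.eq_of_col_eq (h2.2.1.trans h1.2.1) ?_
    rw [hval _ (hpS b hb), hval b hb, Equiv.swap_apply_self]
  rw [map_prod]
  change ∏ b ∈ S, _ = ∏ b ∈ S, _
  refine Finset.prod_nbij' p p hpS hpS hpp hpp fun b hb => ?_
  have h1 := hp b ((hS b).mp hb)
  rw [rename_linFactor, linFactor, hval b hb]
  have h2 := hval b hb
  rcases ((hS b).mp hb).1.2 with h | h
  · rw [h, Equiv.swap_apply_left] at h2 ⊢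
    rw [index_eq_of_pair hR hk h1.2.1.symm h h2]
  · rw [h, Equiv.swap_apply_right] at h2 ⊢
    rw [index_eq_of_pair hR hk h1.2.1 h2 h]

/-- Separates untouched, paired and free cells; only the last product varies over the class. -/
theorem prod_linFactor_of_mem_swapClass (hR : IsReverseTableau R) (hk : k'.val = k.val + 1)
    (Q : Finset (Cell μ)) (hQ : ∀ b, b ∈ Q ∧ (R b = k ∨ R b = k') ↔ Swappable R k k' j b)
    {R' : Cell μ → Fin d} (hR' : R' ∈ swapClass R k k' j) :
    ∏ b ∈ Q, linFactor (R' b) b =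
      (∏ b ∈ Q with ¬ Swappable R k k' j b, linFactor (R b) b) *
      ((∏ b with Swappable R k k' j b ∧ ¬ IsFree R k k' j b, linFactor (R b) b) *
      ∏ b with IsFree R k k' j b, linFactor (R' b) b) := by
  have h1 := (mem_swapClass_iff hR hk R').mp hR'
  have hnf : ∀ b, ¬ IsFree R k k' j b → R' b = R b := fun b hb => by
    have := (Finset.mem_filter.mp (h1 b.1)).2.2.1 b.2
    exact this (by simpa [freeRow] using hb)
  rw [← Finset.prod_filter_not_mul_prod_filter Q (fun b => Swappable R k k' j b)]
  congr 1
  · refine Finset.prod_congr rfl fun b hb => ?_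
    rw [hnf b fun h => (Finset.mem_filter.mp hb).2 h.1]
  · rw [← Finset.prod_filter_not_mul_prod_filter (Q.filter fun b => Swappable R k k' j b)
      (fun b => IsFree R k k' j b)]
    congr 1
    · refine Finset.prod_congr ?_ fun b hb => ?_
      · ext b
        simp only [Finset.mem_filter, Finset.mem_univ, true_and]
        exact ⟨fun h => ⟨h.1.2, h.2⟩, fun h => ⟨⟨((hQ b).mpr h.1).1, h.1⟩, h.2⟩⟩
      · rw [hnf b (Finset.mem_filter.mp hb).2.2]
    · refine Finset.prod_congr ?_ fun b hb => rfl
      ext b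
      simp only [Finset.mem_filter, Finset.mem_univ, true_and]
      exact ⟨fun h => h.2, fun h => ⟨⟨((hQ b).mpr h.1).1, h.1⟩, h⟩⟩

set_option maxHeartbeats 400000 in
/-- The sum over a class of reverse tableaux is symmetric in `x_k` and `x_{k'}`. -/
theorem rename_sum_swapClass (hR : IsReverseTableau R) (hk : k'.val = k.val + 1)
    (H : ∀ b : Cell μ, b.2.val + 1 = j → R b = k → ∃ b' : Cell μ, b'.2.val = b.2.val ∧ R b' = k')
    (Q : Finset (Cell μ)) (hQ : ∀ b, b ∈ Q ∧ (R b = k ∨ R b = k') ↔ Swappable R k k' j b) :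
    rename (Equiv.swap k k') (∑ R' ∈ swapClass R k k' j, ∏ b ∈ Q, linFactor (R' b) b) =
      ∑ R' ∈ swapClass R k k' j, ∏ b ∈ Q, linFactor (R' b) b := by
  rw [Finset.sum_congr rfl fun R' hR' => prod_linFactor_of_mem_swapClass hR hk Q hQ hR',
    ← Finset.mul_sum, ← Finset.mul_sum, map_mul, map_mul, rename_prod_paired hR hk,
    sum_swapClass_free hR hk, map_prod, map_prod]
  congr 1
  · refine Finset.prod_congr rfl fun b hb => ?_
    have hb' := Finset.mem_filter.mp hb
    have : ¬ (R b = k ∨ R b = k') := fun h => hb'.2 ((hQ b).mp ⟨hb'.1, h⟩)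
    push Not at this
    rw [rename_linFactor, Equiv.swap_apply_of_ne_of_ne this.1 this.2, linFactor]
  · congr 1
    exact Finset.prod_congr rfl fun r _ => rename_sum_rowClass hR hk H r

end

/-! ### Symmetry of factorial Schur functions -/

section
variable {d : ℕ} {μ : Partition d}

/-- Replace the entries `k'` by `k` in the columns after the first `j` ones. -/
def mergeEntries (k k' : Fin d) (j : ℕ) (R : Cell μ → Fin d) (b : Cell μ) : Fin d :=
  if j ≤ b.2.val ∧ R b = k' then k else R b

/-- Exhibits the classes as fibres of a map, so that they partition the reverse tableaux. -/
theorem mem_swapClass_iff_merge {k k' : Fin d} (hkk : k ≠ k') (j : ℕ) (R R' : Cell μ → Fin d) :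
    R' ∈ swapClass R k k' j ↔
      IsReverseTableau R' ∧ mergeEntries k k' j R' = mergeEntries k k' j R := by
  simp only [swapClass, Finset.mem_filter, Finset.mem_univ, true_and]
  refine and_congr_right fun _ => ?_
  rw [funext_iff, ← forall_and]
  refine forall_congr' fun b => ?_
  simp only [Swappable, mergeEntries]
  by_cases hj : j ≤ b.2.val
  · simp only [hj, true_and]
    by_cases h1 : R b = k <;> by_cases h2 : R b = k' <;> by_cases h3 : R' b = k <;>
      by_cases h4 : R' b = k' <;> simp_all [eq_comm]
  · simp [hj]

theorem rename_swap_factorialSchur {k k' : Fin d} (hk : k'.val = k.val + 1) :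
    rename (Equiv.swap k k') (factorialSchur μ) = factorialSchur μ := by
  have hkk : k ≠ k' := fun h => by rw [h] at hk; omega
  change rename _ (∑ R : Cell μ → Fin d with IsReverseTableau R, ∏ b, linFactor (R b) b) =
    ∑ R : Cell μ → Fin d with IsReverseTableau R, ∏ b, linFactor (R b) b
  rw [← sub_eq_zero, map_sum, ← Finset.sum_sub_distrib]
  refine Finset.sum_cancels_of_partition_cancels (Setoid.ker (mergeEntries k k' 0)) fun R hR => ?_
  have hR' : IsReverseTableau R := (Finset.mem_filter.mp hR).2
  have he : ((Finset.univ.filter fun R : Cell μ → Fin d => IsReverseTableau R).filter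
      fun R' => (Setoid.ker (mergeEntries k k' 0)) R' R) = swapClass R k k' 0 := by
    ext R'
    rw [mem_swapClass_iff_merge hkk]
    simp [Setoid.ker_def]
  rw [he, Finset.sum_sub_distrib, ← map_sum, sub_eq_zero]
  -- With j = 0 no column is frozen, and the hypothesis on the last frozen column is vacuous.
  exact rename_sum_swapClass hR' hk (fun b hb => by omega) _ (by simp [Swappable])

theorem rename_factorialSchur (σ : Equiv.Perm (Fin d)) :
    rename σ (factorialSchur μ) = factorialSchur μ := by
  match d, μ, σ with
  | 0, μ, σ =>
    have : σ = 1 := Subsingleton.elim _ _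
    subst this
    exact rename_id_apply _
  | n + 1, μ, σ =>
    have hσ : σ ∈ Submonoid.closure
        (Set.range fun i : Fin n => Equiv.swap i.castSucc i.succ) := by
      rw [Equiv.Perm.mclosure_swap_castSucc_succ]; trivial
    induction hσ using Submonoid.closure_induction with
    | mem x hx =>
      obtain ⟨i, rfl⟩ := hx
      exact rename_swap_factorialSchur (by simp)
    | one => exact rename_id_apply _
    | mul x z _ _ hx hz =>
      have : rename (x * z : Equiv.Perm (Fin (n + 1))) (factorialSchur μ) =
          rename x (rename z (factorialSchur μ)) := by
        rw [rename_rename]; rfl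
      rw [this, hz, hx]

/-! ### Reading order, weights and resummation over bars -/

/-- The position of a cell in the column reading order. -/
def key (b : Cell μ) : ℕ := b.2.val * d + (d - 1 - b.1.val)

theorem key_lt_iff {b b' : Cell μ} :
    key b < key b' ↔ b.2.val < b'.2.val ∨ (b.2.val = b'.2.val ∧ b'.1 < b.1) := by
  have h1 := b.1.isLt
  have h2 := b'.1.isLt
  have aux : ∀ m n u v : ℕ, m < n → u < d → m * d + u < n * d + v := by
    intro m n u v h hu
    have : (m + 1) * d ≤ n * d := Nat.mul_le_mul_right d h
    rw [Nat.add_mul] at this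
    omega
  simp only [key, Fin.lt_def]
  rcases lt_trichotomy b.2.val b'.2.val with h | h | h
  · have := aux _ _ (d - 1 - b.1.val) (d - 1 - b'.1.val) h (by omega)
    exact iff_of_true this (Or.inl h)
  · rw [h]; omega
  · have := aux _ _ (d - 1 - b'.1.val) (d - 1 - b.1.val) h (by omega)
    exact iff_of_false (by omega) (by omega)

theorem key_injective : Function.Injective (key : Cell μ → ℕ) := by
  intro b b' h
  have h1 : ¬ key b < key b' := by omega
  have h2 : ¬ key b' < key b := by omega
  rw [key_lt_iff] at h1 h2
  push Not at h1 h2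
  have hc : b.2.val = b'.2.val := le_antisymm h2.1 h1.1
  exact Cell.ext' (le_antisymm (h1.2 hc) (h2.2 hc.symm)) hc

/-- The number of unbarred `k`'s. -/
def unbarred (R : Cell μ → Fin d) (B : Finset (Cell μ)) (k : Fin d) : ℕ :=
  (Finset.univ.filter fun b => b ∉ B ∧ R b = k).card

/-- The number of unbarred `k`'s before the cell `q`. -/
def unbarredBefore (R : Cell μ → Fin d) (B : Finset (Cell μ)) (q : Cell μ) (k : Fin d) : ℕ :=
  (Finset.univ.filter fun b => b ∉ B ∧ R b = k ∧ key b < key q).card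

/-- The number of unbarred `k`'s up to the cell `q`. -/
def unbarredUpTo (R : Cell μ → Fin d) (B : Finset (Cell μ)) (q : Cell μ) (k : Fin d) : ℕ :=
  (Finset.univ.filter fun b => b ∉ B ∧ R b = k ∧ key b ≤ key q).card

/-- The product of the factors belonging to the barred entries. -/
def weight (lam : Partition d) (R : Cell μ → Fin d) (B : Finset (Cell μ)) : YRing :=
  ∏ b ∈ B, (y (flip (R b) + (lam.1 (R b) + unbarredBefore R B b (R b))) - y (index (R b) b))

theorem unbarredUpTo_eq (R : Cell μ → Fin d) (B : Finset (Cell μ)) (q : Cell μ) (k : Fin d) :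
    unbarredUpTo R B q k = unbarredBefore R B q k + if q ∉ B ∧ R q = k then 1 else 0 := by
  have h : (Finset.univ.filter fun b => b ∉ B ∧ R b = k ∧ key b ≤ key q) =
      (Finset.univ.filter fun b => b ∉ B ∧ R b = k ∧ key b < key q) ∪
        if q ∉ B ∧ R q = k then {q} else ∅ := by
    ext b
    have hb : key b ≤ key q ↔ key b < key q ∨ b = q :=
      le_iff_lt_or_eq.trans (or_congr_right key_injective.eq_iff)
    by_cases hq : q ∉ B ∧ R q = k
    · rw [if_pos hq]
      simp only [Finset.mem_filter, Finset.mem_univ, true_and, Finset.mem_union,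
        Finset.mem_singleton, hb]
      constructor
      · tauto
      · rintro (h | rfl)
        · tauto
        · exact ⟨hq.1, hq.2, Or.inr rfl⟩
    · rw [if_neg hq]
      simp only [Finset.mem_filter, Finset.mem_univ, true_and, Finset.union_empty, hb]
      constructor
      · rintro ⟨h1, h2, h3 | rfl⟩
        · exact ⟨h1, h2, h3⟩
        · exact absurd ⟨h1, h2⟩ hq
      · tauto
  rw [unbarredUpTo, unbarredBefore, h, Finset.card_union_of_disjoint]
  · split_ifs <;> simp
  · split_ifs <;> simp

theorem flip_eq_rho (a : Fin d) : flip a = rho a + 1 := by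
  have := a.isLt
  simp only [flip, rho]; omega

theorem card_filter_notMem_union {ι : Type*} [Fintype ι] [DecidableEq ι] {P B₀ B' : Finset ι}
    (h₀ : B₀ ⊆ P) (h' : B' ⊆ Pᶜ) (p : ι → Prop) [DecidablePred p] :
    (Finset.univ.filter fun b => b ∉ B₀ ∪ B' ∧ p b).card =
      ((P \ B₀).filter p).card + ((Pᶜ \ B').filter p).card := by
  rw [← Finset.card_union_of_disjoint]
  · congr 1
    ext b
    have h1 : b ∈ B₀ → b ∈ P := fun h => h₀ h
    have h2 : b ∈ B' → b ∉ P := fun h => Finset.mem_compl.mp (h' h)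
    simp only [Finset.mem_filter, Finset.mem_univ, true_and, Finset.mem_union,
      Finset.mem_sdiff, Finset.mem_compl]
    tauto
  · refine Finset.disjoint_left.mpr fun b hb hb' => ?_
    simp only [Finset.mem_filter, Finset.mem_sdiff, Finset.mem_compl] at hb hb'
    exact hb'.1.1 hb.1.1

set_option maxHeartbeats 400000 in
/-- Resummation over all sets of barred cells with given part in an initial segment `P`. -/
theorem sum_weight_mul_fallingMonomial (lam : Partition d) (R : Cell μ → Fin d)
    (P : Finset (Cell μ)) (hP : ∀ b ∈ P, ∀ b', key b' ≤ key b → b' ∈ P) (B₀ : Finset (Cell μ))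
    (hB₀ : B₀ ⊆ P) :
    (∑ B with B ∩ P = B₀,
        C (weight lam R B) * fallingMonomial fun k => lam.1 k + rho k + unbarred R B k) =
      C (weight lam R B₀) *
        (fallingMonomial (fun k => lam.1 k + rho k + ((P \ B₀).filter fun b => R b = k).card) *
        ∏ b ∈ Pᶜ, linFactor (R b) b) := by
  have hout : ∀ b, b ∉ P → ∀ b' ∈ P, key b' < key b := by
    intro b hb b' hb'
    by_contra h
    exact hb (hP b' hb' b (not_lt.mp h))
  -- The unbarred cells of P enter as initial exponents; only the factors outside P are expanded.
  have := fallingMonomial_mul_prod key key_injective R (fun b => y (index (R b) b))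
    (fun k => lam.1 k + rho k + ((P \ B₀).filter fun b => R b = k).card) Pᶜ
  simp only [linFactor]
  rw [this, Finset.mul_sum]
  symm
  refine Finset.sum_bij (fun B' _ => B₀ ∪ B') ?_ ?_ ?_ ?_
  · intro B' hB'
    have h1 := Finset.mem_powerset.mp hB'
    refine Finset.mem_filter.mpr ⟨Finset.mem_univ _, ?_⟩
    ext b
    have h2 : b ∈ B' → b ∉ P := fun h => Finset.mem_compl.mp (h1 h)
    have h3 : b ∈ B₀ → b ∈ P := fun h => hB₀ h
    simp only [Finset.mem_inter, Finset.mem_union]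
    tauto
  · intro B1 hB1 B2 hB2 h
    have h1 := Finset.mem_powerset.mp hB1
    have h2 := Finset.mem_powerset.mp hB2
    ext b
    have e := congrArg (b ∈ ·) h
    have h3 : b ∈ B1 → b ∉ P := fun h => Finset.mem_compl.mp (h1 h)
    have h4 : b ∈ B2 → b ∉ P := fun h => Finset.mem_compl.mp (h2 h)
    have h5 : b ∈ B₀ → b ∈ P := fun h => hB₀ h
    simp only [Finset.mem_union, eq_iff_iff] at e
    tauto
  · intro B hB
    have h1 := (Finset.mem_filter.mp hB).2
    refine ⟨B \ P, Finset.mem_powerset.mpr fun b hb => ?_, ?_⟩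
    · exact Finset.mem_compl.mpr (Finset.mem_sdiff.mp hb).2
    · rw [← h1]; ext b; simp only [Finset.mem_union, Finset.mem_inter, Finset.mem_sdiff]; tauto
  · intro B' hB'
    have h1 := Finset.mem_powerset.mp hB'
    have h2 : ∀ b ∈ B', b ∉ P := fun b h => Finset.mem_compl.mp (h1 h)
    have hdisj : Disjoint B₀ B' := Finset.disjoint_left.mpr fun b hb hb' => h2 b hb' (hB₀ hb)
    have hcnt : ∀ k, unbarred R (B₀ ∪ B') k = ((P \ B₀).filter fun b => R b = k).card +
        ((Pᶜ \ B').filter fun b => R b = k).card := fun k =>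
      card_filter_notMem_union hB₀ h1 _
    have hb0 : ∀ b ∈ B₀, unbarredBefore R (B₀ ∪ B') b (R b) = unbarredBefore R B₀ b (R b) := by
      intro b hb
      rw [unbarredBefore, unbarredBefore]
      congr 1
      refine Finset.filter_congr fun b' _ => ?_
      have h3 : b' ∈ B' → ¬ key b' < key b := fun h h' =>
        h2 b' h (hP b (hB₀ hb) b' h'.le)
      simp only [Finset.mem_union]
      tauto
    have hb1 : ∀ b ∈ B', unbarredBefore R (B₀ ∪ B') b (R b) =
        ((P \ B₀).filter fun b' => R b' = R b).card +
        ((Pᶜ \ B').filter fun b' => R b' = R b ∧ key b' < key b).card := by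
      intro b hb
      rw [unbarredBefore, card_filter_notMem_union hB₀ h1]
      congr 2
      refine Finset.filter_congr fun b' hb' => and_iff_left ?_
      exact hout b (h2 b hb) b' (Finset.mem_sdiff.mp hb').1
    rw [← mul_assoc, ← C_mul]
    congr 2
    · rw [weight, weight, Finset.prod_union hdisj]
      congr 1
      · exact Finset.prod_congr rfl fun b hb => by rw [hb0 b hb]
      · refine Finset.prod_congr rfl fun b hb => ?_
        -- The shift by one in flip = ρ + 1 matches the new parameter y_{n+1} of a falling power of
        -- exponent n.
        rw [hb1 b hb, flip_eq_rho]
        congr 2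
        omega
    · funext k
      rw [hcnt]; omega

/-! ### Cancellation of the fillings that violate the Yamanouchi condition -/

/-- `lam` followed by the unbarred column word stays a partition all along. -/
def IsYam (lam : Partition d) (R : Cell μ → Fin d) (B : Finset (Cell μ)) (q : Cell μ) : Prop :=
  ∀ k k' : Fin d, k'.val = k.val + 1 →
    lam.1 k' + unbarredUpTo R B q k' ≤ lam.1 k + unbarredUpTo R B q k

/-- What is read before q is what is read up to its predecessor, or nothing; in the latter case λ
itself is a partition. -/
theorem le_unbarredBefore_of_isYam {lam : Partition d} {R : Cell μ → Fin d}
    {B : Finset (Cell μ)} {q : Cell μ} (h : ∀ p, key p < key q → IsYam lam R B p) {k k' : Fin d}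
    (hk : k'.val = k.val + 1) :
    lam.1 k' + unbarredBefore R B q k' ≤ lam.1 k + unbarredBefore R B q k := by
  rcases (Finset.univ.filter fun p : Cell μ => key p < key q).eq_empty_or_nonempty with he | hne
  · have h0 : ∀ a, unbarredBefore R B q a = 0 := by
      intro a
      rw [unbarredBefore, Finset.card_eq_zero, Finset.filter_eq_empty_iff]
      intro b _ hb
      have : b ∈ (Finset.univ.filter fun p : Cell μ => key p < key q) := by simp [hb.2.2]
      rw [he] at this
      simp at this
    rw [h0, h0]
    exact lam.2 (by rw [Fin.le_def]; omega)
  · obtain ⟨p, hp, hmax⟩ := Finset.exists_max_image _ key hne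
    have hp' : key p < key q := (Finset.mem_filter.mp hp).2
    have h1 : ∀ a, unbarredBefore R B q a = unbarredUpTo R B p a := by
      intro a
      rw [unbarredBefore, unbarredUpTo]
      congr 1
      refine Finset.filter_congr fun b _ => and_congr_right fun _ => and_congr_right fun _ => ?_
      exact ⟨fun hb => hmax b (by simp [hb]), fun hb => hb.trans_lt hp'⟩
    rw [h1, h1]
    exact h p hp' k k' hk

/-- The condition `IsYam` is violated at `q` for the first time. -/
def IsFirstBad (lam : Partition d) (R : Cell μ → Fin d) (B : Finset (Cell μ)) (q : Cell μ) :
    Prop :=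
  ¬ IsYam lam R B q ∧ ∀ p, key p < key q → IsYam lam R B p

/-- The inequality holds before q and one cell changes one count by at most one. So q must be an
unbarred k', and the violation is by exactly one. -/
theorem IsFirstBad.spec {lam : Partition d} {R : Cell μ → Fin d}
    {B : Finset (Cell μ)} {q : Cell μ} (h : IsFirstBad lam R B q) :
    ∃ k : Fin d, (R q).val = k.val + 1 ∧
      lam.1 (R q) + unbarredUpTo R B q (R q) = lam.1 k + unbarredUpTo R B q k + 1 := by
  obtain ⟨h1, h2⟩ := h
  simp only [IsYam] at h1
  push Not at h1
  obtain ⟨k, k', hk, hlt⟩ := h1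
  have h3 := le_unbarredBefore_of_isYam h2 hk
  rw [unbarredUpTo_eq, unbarredUpTo_eq] at hlt
  have hkk : k ≠ k' := fun e => by rw [e] at hk; omega
  by_cases hq : q ∉ B ∧ R q = k'
  · have hq' : ¬ (q ∉ B ∧ R q = k) := fun e => hkk (e.2.symm.trans hq.2)
    rw [if_pos hq, if_neg hq'] at hlt
    refine ⟨k, by rw [hq.2, hk], ?_⟩
    rw [hq.2, unbarredUpTo_eq, unbarredUpTo_eq, if_pos hq, if_neg hq']
    omega
  · rw [if_neg hq] at hlt
    split_ifs at hlt <;> omega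

theorem exists_isFirstBad {lam : Partition d} {R : Cell μ → Fin d} {B : Finset (Cell μ)}
    (h : ¬ ∀ q, IsYam lam R B q) : ∃ q, IsFirstBad lam R B q := by
  push Not at h
  obtain ⟨q, hq⟩ := h
  obtain ⟨p, hp, hmin⟩ := Finset.exists_min_image
    (Finset.univ.filter fun q : Cell μ => ¬ IsYam lam R B q) key ⟨q, by simp [hq]⟩
  refine ⟨p, (Finset.mem_filter.mp hp).2, fun p' hp' => ?_⟩
  by_contra hcon
  exact absurd (hmin p' (by simp [hcon])) hp'.not_ge

theorem IsFirstBad.unique {lam : Partition d} {R : Cell μ → Fin d} {B : Finset (Cell μ)}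
    {q q' : Cell μ} (h : IsFirstBad lam R B q) (h' : IsFirstBad lam R B q') : q = q' := by
  refine key_injective (le_antisymm ?_ ?_)
  · exact not_lt.mp fun hlt => h'.1 (h.2 q' hlt)
  · exact not_lt.mp fun hlt => h.1 (h'.2 q hlt)

theorem unbarredUpTo_congr {R R' : Cell μ → Fin d} {B B' : Finset (Cell μ)} {q p : Cell μ}
    (hR : ∀ b, key b ≤ key q → R b = R' b) (hB : ∀ b, key b ≤ key q → (b ∈ B ↔ b ∈ B'))
    (hp : key p ≤ key q) (k : Fin d) : unbarredUpTo R B p k = unbarredUpTo R' B' p k := by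
  rw [unbarredUpTo, unbarredUpTo]
  congr 1
  refine Finset.filter_congr fun b _ => ?_
  by_cases hb : key b ≤ key p
  · rw [hR b (hb.trans hp), hB b (hb.trans hp)]
  · simp [hb]

theorem IsFirstBad.congr {lam : Partition d} {R R' : Cell μ → Fin d} {B B' : Finset (Cell μ)}
    {q : Cell μ} (h : IsFirstBad lam R B q) (hR : ∀ b, key b ≤ key q → R b = R' b)
    (hB : ∀ b, key b ≤ key q → (b ∈ B ↔ b ∈ B')) : IsFirstBad lam R' B' q := by
  have hy : ∀ p, key p ≤ key q → (IsYam lam R B p ↔ IsYam lam R' B' p) := by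
    intro p hp
    simp only [IsYam, unbarredUpTo_congr hR hB hp]
  exact ⟨fun h' => h.1 ((hy q le_rfl).mpr h'), fun p hp => (hy p hp.le).mp (h.2 p hp)⟩

/-- The term of `a_{λ + ρ} s_μ` belonging to the filling `(R, B)`. -/
def term (lam : Partition d) (T : (Cell μ → Fin d) × Finset (Cell μ)) :
    MvPolynomial (Fin d) YRing :=
  C (weight lam T.1 T.2) *
    alt (fallingMonomial fun k => lam.1 k + rho k + unbarred T.1 T.2 k)

theorem alternant_mul_factorialSchur_eq_sum (lam : Partition d) :
    alternant lam * factorialSchur μ =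
      ∑ T : (Cell μ → Fin d) × Finset (Cell μ) with IsReverseTableau T.1, term lam T := by
  have h1 : (Finset.univ.filter fun T : (Cell μ → Fin d) × Finset (Cell μ) =>
      IsReverseTableau T.1) = (Finset.univ.filter fun R : Cell μ → Fin d =>
      IsReverseTableau R) ×ˢ (Finset.univ : Finset (Finset (Cell μ))) := by
    ext T; simp
  rw [h1, Finset.sum_product, alternant, ← alt_mul_of_symmetric _ _ rename_factorialSchur]
  change alt (_ * ∑ R : Cell μ → Fin d with IsReverseTableau R, ∏ b, linFactor (R b) b) = _
  rw [Finset.mul_sum, map_sum]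
  refine Finset.sum_congr rfl fun R _ => ?_
  have h2 := sum_weight_mul_fallingMonomial lam R ∅ (by simp) ∅ (by simp)
  simp only [Finset.inter_empty, Finset.filter_true, Finset.empty_sdiff, Finset.filter_empty,
    Finset.card_empty, add_zero, Finset.compl_empty, weight, Finset.prod_empty, C_1,
    one_mul] at h2
  rw [← h2, map_sum]
  exact Finset.sum_congr rfl fun B _ => alt_C_mul _ _

/-- The fillings are grouped by the bars up to q and by the tableau up to exchanges of k and k' in
the columns read after that of q. Each group sums to a constant times the antisymmetrization of
something symmetric in x_k and x_{k'}. -/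
theorem sum_term_isFirstBad_eq_zero (lam : Partition d) (q : Cell μ) (k' : Fin d) :
    (∑ T : (Cell μ → Fin d) × Finset (Cell μ) with
      (IsReverseTableau T.1 ∧ IsFirstBad lam T.1 T.2 q) ∧ T.1 q = k', term lam T) = 0 := by
  by_cases hk0 : k'.val = 0
  · refine Finset.sum_eq_zero fun T hT => ?_
    obtain ⟨k, hk, _⟩ := (Finset.mem_filter.mp hT).2.1.2.spec
    rw [(Finset.mem_filter.mp hT).2.2] at hk
    omega
  have hk : k'.val = (⟨k'.val - 1, by omega⟩ : Fin d).val + 1 := by simp; omega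
  generalize (⟨k'.val - 1, by omega⟩ : Fin d) = k at hk
  have hkk : k ≠ k' := fun h => by rw [h] at hk; omega
  let P : Finset (Cell μ) := Finset.univ.filter fun b => key b ≤ key q
  have hP : ∀ b, b ∈ P ↔ key b ≤ key q := by simp [P]
  let j := q.2.val + 1
  have hPj : ∀ b ∈ P, b.2.val < j := by
    intro b hb
    by_contra h
    have : key q < key b := key_lt_iff.mpr (Or.inl (by omega))
    exact absurd ((hP b).mp hb) this.not_ge
  refine Finset.sum_cancels_of_partition_cancels
    (Setoid.ker fun T : (Cell μ → Fin d) × Finset (Cell μ) =>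
      (mergeEntries k k' j T.1, T.2 ∩ P)) fun T₀ hT₀ => ?_
  obtain ⟨R₀, B₀⟩ := T₀
  obtain ⟨⟨hR₀, hbad⟩, hq⟩ := (Finset.mem_filter.mp hT₀).2
  simp only at hR₀ hbad hq
  have hagree : ∀ R ∈ swapClass R₀ k k' j, ∀ b ∈ P, R b = R₀ b := by
    intro R hR b hb
    refine (Finset.mem_filter.mp hR).2.2.1 b fun h => ?_
    exact absurd h.1 (hPj b hb).not_ge
  have he : ((Finset.univ.filter fun T : (Cell μ → Fin d) × Finset (Cell μ) =>
      (IsReverseTableau T.1 ∧ IsFirstBad lam T.1 T.2 q) ∧ T.1 q = k').filter fun T =>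
        (Setoid.ker fun T : (Cell μ → Fin d) × Finset (Cell μ) =>
          (mergeEntries k k' j T.1, T.2 ∩ P)) T (R₀, B₀)) =
      swapClass R₀ k k' j ×ˢ Finset.univ.filter fun B => B ∩ P = B₀ ∩ P := by
    ext ⟨R, B⟩
    rw [Finset.mem_product, mem_swapClass_iff_merge hkk]
    simp only [Finset.mem_filter, Finset.mem_univ, true_and, Setoid.ker_def, Prod.mk.injEq]
    constructor
    · tauto
    · rintro ⟨⟨h1, h2⟩, h3⟩
      have h4 := hagree R ((mem_swapClass_iff_merge hkk j R₀ R).mpr ⟨h1, h2⟩)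
      refine ⟨⟨⟨h1, hbad.congr (fun b hb => (h4 b ((hP b).mpr hb)).symm) fun b hb => ?_⟩, ?_⟩,
        h2, h3⟩
      · have h5 := congrArg (b ∈ ·) h3
        have h6 := (hP b).mpr hb
        simp only [Finset.mem_inter, h6, and_true, eq_iff_iff] at h5
        exact h5.symm
      · rw [h4 q ((hP q).mpr le_rfl), hq]
  rw [he, Finset.sum_product]
  have hlow : ∀ b ∈ P, ∀ b', key b' ≤ key b → b' ∈ P := fun b hb b' h =>
    (hP b').mpr (h.trans ((hP b).mp hb))
  have hin : ∀ R ∈ swapClass R₀ k k' j, (∑ B with B ∩ P = B₀ ∩ P, term lam (R, B)) =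
      alt (C (weight lam R₀ (B₀ ∩ P)) *
        (fallingMonomial (fun i => lam.1 i + rho i + unbarredUpTo R₀ B₀ q i) *
        ∏ b ∈ Pᶜ, linFactor (R b) b)) := by
    intro R hR
    have h1 := hagree R hR
    have h2 := sum_weight_mul_fallingMonomial lam R P hlow (B₀ ∩ P) Finset.inter_subset_right
    have h3 : weight lam R (B₀ ∩ P) = weight lam R₀ (B₀ ∩ P) := by
      refine Finset.prod_congr rfl fun b hb => ?_
      have hbP := (Finset.mem_inter.mp hb).2
      have h4 : unbarredBefore R (B₀ ∩ P) b (R₀ b) = unbarredBefore R₀ (B₀ ∩ P) b (R₀ b) := by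
        rw [unbarredBefore, unbarredBefore]
        congr 1
        refine Finset.filter_congr fun b' _ => ?_
        by_cases hb' : key b' < key b
        · rw [h1 b' (hlow b hbP b' hb'.le)]
        · simp [hb']
      rw [h1 b hbP, h4]
    have h5 : ∀ i, ((P \ (B₀ ∩ P)).filter fun b => R b = i).card = unbarredUpTo R₀ B₀ q i := by
      intro i
      rw [unbarredUpTo]
      congr 1
      ext b
      simp only [Finset.mem_filter, Finset.mem_sdiff, Finset.mem_inter, Finset.mem_univ, true_and,
        ← hP]
      by_cases hb : b ∈ P
      · rw [h1 b hb]; tauto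
      · tauto
    rw [h3] at h2
    simp only [h5] at h2
    rw [← h2, map_sum]
    exact Finset.sum_congr rfl fun B _ => (alt_C_mul _ _).symm
  rw [Finset.sum_congr rfl hin, ← map_sum, ← Finset.mul_sum, ← Finset.mul_sum, alt_C_mul,
    alt_eq_zero _ hkk, mul_zero]
  rw [map_mul, rename_fallingMonomial, rename_sum_swapClass hR₀ hk]
  · congr 2
    funext i
    obtain ⟨k₁, hk₁, hbal⟩ := hbad.spec
    obtain rfl : k₁ = k := by ext; rw [hq] at hk₁; omega
    rw [hq] at hbal
    -- The excess of one at k' is offset by the drop of one in ρ, so both variables have the same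
    -- exponent.
    have hrho : rho k₁ = rho k' + 1 := by
      have := k'.isLt
      simp only [rho]; omega
    simp only [Function.comp, Equiv.symm_swap]
    by_cases h1 : i = k₁
    · rw [h1, Equiv.swap_apply_left]; omega
    by_cases h2 : i = k'
    · rw [h2, Equiv.swap_apply_right]; omega
    rw [Equiv.swap_apply_of_ne_of_ne h1 h2]
  · intro b hb _
    -- The last frozen column is that of q, and q itself is the required k'.
    exact ⟨q, by simp only [j] at hb; omega, hq⟩
  · intro b
    rw [Finset.mem_compl, hP, not_le, key_lt_iff, Swappable]
    constructor
    · rintro ⟨h | h, h'⟩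
      · exact ⟨h, h'⟩
      -- Unread cells in the column of q lie below q, so their entries exceed k'.
      · have h3 := hR₀.col_lt h.1 h.2
        rw [hq, Fin.lt_def] at h3
        simp only [Fin.ext_iff] at h'
        omega
    · rintro ⟨h, h'⟩
      exact ⟨Or.inl h, h'⟩

/-- The reverse tableaux with barred entries that keep `lam` a partition all along. -/
def yamFillings (lam μ : Partition d) : Finset ((Cell μ → Fin d) × Finset (Cell μ)) :=
  Finset.univ.filter fun T => IsReverseTableau T.1 ∧ ∀ q, IsYam lam T.1 T.2 q

/-- Every other filling has exactly one first bad cell, so the rest of the sum splits over that cell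
and its entry. -/
theorem alternant_mul_factorialSchur (lam : Partition d) :
    alternant lam * factorialSchur μ = ∑ T ∈ yamFillings lam μ, term lam T := by
  rw [alternant_mul_factorialSchur_eq_sum,
    ← Finset.sum_filter_add_sum_filter_not _ (fun T => ∀ q, IsYam lam T.1 T.2 q),
    Finset.filter_filter]
  refine add_eq_left.mpr ?_
  rw [Finset.filter_filter]
  have h1 : ∀ T ∈ Finset.univ.filter (fun T : (Cell μ → Fin d) × Finset (Cell μ) =>
      IsReverseTableau T.1 ∧ ¬ ∀ q, IsYam lam T.1 T.2 q), term lam T =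
      ∑ q, if IsFirstBad lam T.1 T.2 q then term lam T else 0 := by
    intro T hT
    obtain ⟨q, hq⟩ := exists_isFirstBad (Finset.mem_filter.mp hT).2.2
    rw [Finset.sum_eq_single q, if_pos hq]
    · intro p _ hp
      exact if_neg fun h => hp (h.unique hq)
    · simp
  rw [Finset.sum_congr rfl h1, Finset.sum_comm]
  refine Finset.sum_eq_zero fun q _ => ?_
  rw [← Finset.sum_filter, Finset.filter_filter, ← Finset.sum_fiberwise _ (fun T => T.1 q)]
  refine Finset.sum_eq_zero fun k' _ => ?_
  rw [Finset.filter_filter, ← sum_term_isFirstBad_eq_zero lam q k']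
  refine Finset.sum_congr (Finset.filter_congr fun T _ => ?_) fun _ _ => rfl
  constructor
  · rintro ⟨⟨⟨h1, _⟩, h2⟩, h3⟩
    exact ⟨⟨h1, h2⟩, h3⟩
  · rintro ⟨⟨h1, h2⟩, h3⟩
    exact ⟨⟨⟨h1, fun h => h2.1 (h q)⟩, h2⟩, h3⟩

end

/-! ### Positivity of the factors of a nonzero weight -/

theorem antitone_of_succ_le {d : ℕ} {f : Fin d → ℕ}
    (h : ∀ k k' : Fin d, k'.val = k.val + 1 → f k' ≤ f k) : Antitone f := by
  have aux : ∀ n (a b : Fin d), b.val = a.val + n → f b ≤ f a := by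
    intro n
    induction n with
    | zero => intro a b hab; rw [Fin.ext (hab.trans (Nat.add_zero _))]
    | succ n ih =>
      intro a b hab
      have := b.isLt
      exact (h ⟨a.val + n, by omega⟩ b (by simp; omega)).trans (ih a _ rfl)
  intro a b hab
  exact aux (b.val - a.val) a b (by rw [Fin.le_def] at hab; omega)

section
variable {d : ℕ} {lam μ : Partition d} {R : Cell μ → Fin d} {B : Finset (Cell μ)}

theorem antitone_add_unbarred (hy : ∀ q, IsYam lam R B q) :
    Antitone fun k => lam.1 k + unbarred R B k := by
  refine antitone_of_succ_le fun k k' hk => ?_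
  rcases isEmpty_or_nonempty (Cell μ) with he | hne
  · simp only [unbarred, Finset.univ_eq_empty, Finset.filter_empty, Finset.card_empty, add_zero]
    exact lam.2 (by rw [Fin.le_def]; omega)
  · obtain ⟨q, _, hq⟩ := Finset.exists_max_image Finset.univ (key : Cell μ → ℕ)
      Finset.univ_nonempty
    have h : ∀ a, unbarred R B a = unbarredUpTo R B q a := by
      intro a
      rw [unbarred, unbarredUpTo]
      simp only [hq _ (Finset.mem_univ _), and_true]
    rw [h, h]
    exact hy q k k' hk

theorem unbarredUpTo_le_unbarredBefore {b b' : Cell μ} (h : key b < key b') (a : Fin d) :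
    unbarredUpTo R B b a ≤ unbarredBefore R B b' a :=
  Finset.card_le_card fun x hx => by
    simp only [Finset.mem_filter, Finset.mem_univ, true_and] at hx ⊢
    exact ⟨hx.1, hx.2.1, hx.2.2.trans_lt h⟩

theorem ne_of_weight_ne_zero (hw : weight lam R B ≠ 0) {b : Cell μ} (hb : b ∈ B) :
    lam.1 (R b) + unbarredBefore R B b (R b) + b.1.val ≠ b.2.val := by
  intro h
  refine hw (Finset.prod_eq_zero hb ?_)
  rw [sub_eq_zero, index]
  congr 1
  simp only [Cell.row, Cell.col]
  omega

/-- Induction along the row, from right to left. At each step the entry weakly decreases, so by the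
Yamanouchi condition its count can only gain. The needed extra one comes from the previous cell: if
unbarred, it is counted; if barred, its factor is nonzero and its inequality was strict. -/
theorem col_le_of_weight_ne_zero (hR : IsReverseTableau R) (hy : ∀ q, IsYam lam R B q)
    (hw : weight lam R B ≠ 0) (b : Cell μ) :
    b.2.val ≤ lam.1 (R b) + unbarredBefore R B b (R b) + b.1.val := by
  obtain ⟨r, ⟨c, hc⟩⟩ := b
  induction c with
  | zero => exact Nat.zero_le _
  | succ c ih =>
    have hc' : c < μ.1 r := by omega
    have h1 := ih hc'
    have hlt : key (⟨r, ⟨c, hc'⟩⟩ : Cell μ) < key (⟨r, ⟨c + 1, hc⟩⟩ : Cell μ) :=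
      key_lt_iff.mpr (Or.inl (Nat.lt_succ_self c))
    have h2 : R ⟨r, ⟨c + 1, hc⟩⟩ ≤ R ⟨r, ⟨c, hc'⟩⟩ := hR.row_le rfl (Nat.le_succ c)
    have h3 : lam.1 (R ⟨r, ⟨c, hc'⟩⟩) +
          unbarredBefore R B ⟨r, ⟨c + 1, hc⟩⟩ (R ⟨r, ⟨c, hc'⟩⟩) ≤
        lam.1 (R ⟨r, ⟨c + 1, hc⟩⟩) +
          unbarredBefore R B ⟨r, ⟨c + 1, hc⟩⟩ (R ⟨r, ⟨c + 1, hc⟩⟩) :=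
      antitone_of_succ_le (f := fun k => lam.1 k + unbarredBefore R B ⟨r, ⟨c + 1, hc⟩⟩ k)
        (fun k k' hk => le_unbarredBefore_of_isYam (fun p _ => hy p) hk) h2
    have h4 := unbarredUpTo_le_unbarredBefore (R := R) (B := B) hlt (R ⟨r, ⟨c, hc'⟩⟩)
    rw [unbarredUpTo_eq] at h4
    by_cases hb : (⟨r, ⟨c, hc'⟩⟩ : Cell μ) ∈ B
    · have h5 := ne_of_weight_ne_zero hw hb
      simp only at h1 h5 ⊢
      omega
    · rw [if_pos ⟨hb, rfl⟩] at h4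
      simp only at h1 ⊢
      omega

theorem index_lt_of_weight_ne_zero (hR : IsReverseTableau R) (hy : ∀ q, IsYam lam R B q)
    (hw : weight lam R B ≠ 0) {b : Cell μ} (hb : b ∈ B) :
    index (R b) b < flip (R b) + (lam.1 (R b) + unbarredBefore R B b (R b)) := by
  have h1 := col_le_of_weight_ne_zero hR hy hw b
  have h2 := ne_of_weight_ne_zero hw hb
  have h3 := index_pos hR b
  simp only [index, Cell.row, Cell.col] at *
  omega

/-! ### The case λ = 0: the bialternant formula -/

/-- The height of column `c`. -/
def height (μ : Partition d) (c : ℕ) : ℕ := (Finset.univ.filter fun r => c < μ.1 r).card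

theorem lt_height_iff (μ : Partition d) (c : ℕ) (r : Fin d) : r.val < height μ c ↔ c < μ.1 r := by
  constructor
  · intro h
    by_contra hc
    have : (Finset.univ.filter fun r => c < μ.1 r) ⊆ Finset.Iio r := by
      intro r' hr'
      simp only [Finset.mem_filter, Finset.mem_univ, true_and, Finset.mem_Iio] at hr' ⊢
      by_contra hle
      exact hc (hr'.trans_le (μ.2 (not_lt.mp hle)))
    have := Finset.card_le_card this
    rw [Fin.card_Iio] at this
    exact absurd h (not_lt.mpr this)
  · intro h
    have : Finset.Iic r ⊆ (Finset.univ.filter fun r => c < μ.1 r) := by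
      intro r' hr'
      simp only [Finset.mem_filter, Finset.mem_univ, true_and, Finset.mem_Iic] at hr' ⊢
      exact h.trans_le (μ.2 hr')
    have := Finset.card_le_card this
    rw [Fin.card_Iic] at this
    exact this

theorem height_le (μ : Partition d) (c : ℕ) : height μ c ≤ d :=
  (Finset.card_le_univ _).trans_eq (Fintype.card_fin d)

theorem height_antitone (μ : Partition d) : Antitone (height μ) := fun _ _ h =>
  Finset.card_le_card fun r hr => by
    simp only [Finset.mem_filter, Finset.mem_univ, true_and] at hr ⊢
    omega

/-- The filling of the columns with `1, 2, …` from top to bottom. -/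
def stdFilling (μ : Partition d) (b : Cell μ) : Fin d :=
  ⟨height μ b.2.val - 1 - b.1.val, by have := height_le μ b.2.val; have := b.1.isLt; omega⟩

theorem row_lt_height (b : Cell μ) : b.1.val < height μ b.2.val :=
  (lt_height_iff μ _ _).mpr b.2.isLt

theorem isReverseTableau_stdFilling (μ : Partition d) : IsReverseTableau (stdFilling μ) := by
  refine ⟨fun b b' h1 h2 => ?_, fun b b' h1 h2 => ?_⟩ <;>
    simp only [Cell.row, Cell.col, add_left_inj, add_le_add_iff_right, add_lt_add_iff_right]
      at h1 h2
  · have := height_antitone μ h2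
    rw [Fin.le_def]
    simp only [stdFilling]
    omega
  · have := row_lt_height b
    rw [Fin.lt_def]
    simp only [stdFilling, ← h1]
    omega

/-- Each k' has a k directly above it, which is read earlier. -/
theorem isYam_stdFilling (μ : Partition d) (q : Cell μ) :
    IsYam (zeroPartition d) (stdFilling μ) ∅ q := by
  intro k k' hk
  simp only [zeroPartition, zero_add]
  have hex : ∀ b : Cell μ, stdFilling μ b = k' →
      ∃ a : Cell μ, a.2.val = b.2.val ∧ a.1.val = b.1.val + 1 := by
    intro b hb
    have h1 := congrArg Fin.val hb
    simp only [stdFilling] at h1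
    have h2 : b.1.val + 1 < height μ b.2.val := by omega
    have h3 : b.1.val + 1 < d := h2.trans_le (height_le _ _)
    exact ⟨⟨⟨b.1.val + 1, h3⟩, ⟨b.2.val, (lt_height_iff μ _ ⟨b.1.val + 1, h3⟩).mp h2⟩⟩, rfl, rfl⟩
  choose! p hp using hex
  refine Finset.card_le_card_of_injOn p ?_ ?_
  · intro b hb
    simp only [Finset.coe_filter, Finset.mem_univ, true_and, Finset.notMem_empty,
      not_false_eq_true, Set.mem_ofPred_eq] at hb ⊢
    obtain ⟨h1, h2⟩ := hp b hb.1
    have h3 := congrArg Fin.val hb.1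
    refine ⟨?_, le_trans (le_of_lt (key_lt_iff.mpr (Or.inr ⟨h1, ?_⟩))) hb.2⟩
    · ext
      simp only [stdFilling, h1, h2] at h3 ⊢
      omega
    · rw [Fin.lt_def, h2]; omega
  · intro b hb b' hb' h
    simp only [Finset.coe_filter, Finset.mem_univ, true_and, Finset.notMem_empty,
      not_false_eq_true, Set.mem_ofPred_eq] at hb hb'
    have h1 := hp b hb.1
    have h2 := hp b' hb'.1
    rw [h] at h1
    exact Cell.ext' (Fin.ext (by omega)) (by omega)

theorem unbarred_stdFilling (μ : Partition d) (k : Fin d) :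
    unbarred (stdFilling μ) ∅ k = μ.1 k := by
  rw [← Finset.card_range (μ.1 k), unbarred]
  refine Finset.card_bij (fun b _ => b.2.val) ?_ ?_ ?_
  · intro b hb
    have h1 := congrArg Fin.val (Finset.mem_filter.mp hb).2.2
    have h2 := row_lt_height b
    simp only [stdFilling] at h1
    exact Finset.mem_range.mpr ((lt_height_iff μ _ k).mp (by omega))
  · intro b hb b' hb' h
    exact (isReverseTableau_stdFilling μ).eq_of_col_eq h
      ((Finset.mem_filter.mp hb).2.2.trans (Finset.mem_filter.mp hb').2.2.symm)
  · intro c hc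
    have h1 := (lt_height_iff μ c k).mpr (Finset.mem_range.mp hc)
    have h2 := height_le μ c
    have h3 : height μ c - 1 - k.val < d := by omega
    refine ⟨⟨⟨height μ c - 1 - k.val, h3⟩, ⟨c, (lt_height_iff μ c _).mp (by simp; omega)⟩⟩, ?_, rfl⟩
    simp only [Finset.mem_filter, Finset.mem_univ, true_and, Finset.notMem_empty,
      not_false_eq_true]
    ext
    simp only [stdFilling]
    omega

/-- For a filling of nonzero weight with Yamanouchi unbarred word, each column contains all values
up to its bottom entry, without bars. -/
theorem exists_mem_column (hR : IsReverseTableau R)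
    (hy : ∀ q, IsYam (zeroPartition d) R B q) (hw : weight (zeroPartition d) R B ≠ 0)
    {q : Cell μ} (hq : q.1.val = 0) {v : Fin d} (hv : v ≤ R q) :
    ∃ b, b.2.val = q.2.val ∧ R b = v ∧ b ∉ B := by
  have h1 := col_le_of_weight_ne_zero hR hy hw q
  -- For the bottom cell q of column c and λ = 0, at least c copies of its entry precede it by
  -- `col_le_of_weight_ne_zero`, and at most c because columns are strict. So equality holds and a
  -- bar on q would give a zero factor.
  have h2 : unbarredBefore R B q (R q) ≤ q.2.val := by
    rw [← Finset.card_range q.2.val]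
    refine Finset.card_le_card_of_injOn (fun b => b.2.val) ?_ ?_
    · intro b hb
      simp only [Finset.coe_filter, Finset.mem_univ, true_and, Set.mem_ofPred_eq] at hb
      simp only [Finset.coe_range, Set.mem_Iio]
      rcases key_lt_iff.mp hb.2.2 with h | h
      · exact h
      · have := hR.eq_of_col_eq h.1 hb.2.1
        exact absurd h.2 (by rw [this]; exact lt_irrefl _)
    · intro b hb b' hb' h
      simp only [Finset.coe_filter, Finset.mem_univ, true_and, Set.mem_ofPred_eq] at hb hb'
      exact hR.eq_of_col_eq h (hb.2.1.trans hb'.2.1.symm)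
  have hqB : q ∉ B := fun h => by
    have h3 := ne_of_weight_ne_zero hw h
    simp only [zeroPartition, zero_add, hq] at h1 h3
    omega
  have h3 : q.2.val + 1 ≤ unbarredUpTo R B q v := by
    have h4 : (zeroPartition d).1 (R q) + unbarredUpTo R B q (R q) ≤
        (zeroPartition d).1 v + unbarredUpTo R B q v :=
      antitone_of_succ_le (f := fun k => (zeroPartition d).1 k + unbarredUpTo R B q k) (hy q) hv
    rw [unbarredUpTo_eq (k := R q), if_pos ⟨hqB, rfl⟩] at h4
    simp only [zeroPartition, zero_add, hq] at h1 h4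
    omega
  -- By the Yamanouchi condition v occurs c + 1 times unbarred in the first c + 1 columns, at most
  -- once in each, hence also in column c.
  obtain ⟨b, hb, hbc⟩ := Finset.surjOn_of_injOn_of_card_le
    (s := Finset.univ.filter fun b => b ∉ B ∧ R b = v ∧ key b ≤ key q)
    (t := Finset.range (q.2.val + 1)) (fun b : Cell μ => b.2.val) (by
      intro b hb
      simp only [Finset.coe_filter, Finset.mem_univ, true_and, Set.mem_ofPred_eq] at hb
      simp only [Finset.coe_range, Set.mem_Iio]
      by_contra h
      have : key q < key b := key_lt_iff.mpr (Or.inl (by omega))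
      omega) (by
      intro b hb b' hb' h
      simp only [Finset.coe_filter, Finset.mem_univ, true_and, Set.mem_ofPred_eq] at hb hb'
      exact hR.eq_of_col_eq h (hb.2.1.trans hb'.2.1.symm))
    (by rw [Finset.card_range]; exact h3)
    (show q.2.val ∈ ((Finset.range (q.2.val + 1) : Finset ℕ) : Set ℕ) by simp)
  simp only [Finset.coe_filter, Finset.mem_univ, true_and, Set.mem_ofPred_eq] at hb
  exact ⟨b, hbc, hb.2.1, hb.1⟩

theorem add_row_le (hR : IsReverseTableau R) (r : ℕ) (hr : r < d) (c : ℕ)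
    (hc : c < μ.1 ⟨r, hr⟩) (hd : 0 < d) (h0 : c < μ.1 ⟨0, hd⟩) :
    (R ⟨⟨r, hr⟩, ⟨c, hc⟩⟩).val + r ≤ (R ⟨⟨0, hd⟩, ⟨c, h0⟩⟩).val := by
  induction r with
  | zero => exact le_rfl
  | succ r ih =>
    have hr' : r < d := by omega
    have hc' : c < μ.1 ⟨r, hr'⟩ := hc.trans_le (μ.2 (by rw [Fin.le_def]; simp))
    have h1 : R ⟨⟨r + 1, hr⟩, ⟨c, hc⟩⟩ < R ⟨⟨r, hr'⟩, ⟨c, hc'⟩⟩ :=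
      hR.col_lt rfl (by rw [Fin.lt_def]; simp)
    have := ih hr' hc'
    rw [Fin.lt_def] at h1
    omega

theorem height_le_add_row (hR : IsReverseTableau R) (n : ℕ) (b : Cell μ)
    (h : b.1.val + n + 1 = height μ b.2.val) : n ≤ (R b).val := by
  induction n generalizing b with
  | zero => exact Nat.zero_le _
  | succ n ih =>
    have h3 : b.1.val + 1 < d := by have := height_le μ b.2.val; omega
    have hc : b.2.val < μ.1 ⟨b.1.val + 1, h3⟩ := (lt_height_iff μ _ _).mp (by simp; omega)
    have h1 : R ⟨⟨b.1.val + 1, h3⟩, ⟨b.2.val, hc⟩⟩ < R b :=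
      hR.col_lt rfl (by rw [Fin.lt_def]; simp)
    have h2 := ih ⟨⟨b.1.val + 1, h3⟩, ⟨b.2.val, hc⟩⟩ (by simp; omega)
    rw [Fin.lt_def] at h1
    omega

/-- All values up to the bottom entry occur in the column, so the bottom entry is at most the
height, and strictness determines the rest. They occur unbarred and only once, so no cell is barred.
-/
theorem eq_stdFilling (hR : IsReverseTableau R)
    (hy : ∀ q, IsYam (zeroPartition d) R B q) (hw : weight (zeroPartition d) R B ≠ 0) :
    R = stdFilling μ ∧ B = ∅ := by
  have hbot : ∀ b : Cell μ, ∃ q : Cell μ, q.1.val = 0 ∧ q.2.val = b.2.val ∧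
      (R b).val + b.1.val ≤ (R q).val := by
    intro b
    have hd : 0 < d := b.1.pos
    have h0 : b.2.val < μ.1 ⟨0, hd⟩ := b.2.isLt.trans_le (μ.2 (by rw [Fin.le_def]; simp))
    exact ⟨⟨⟨0, hd⟩, ⟨b.2.val, h0⟩⟩, rfl, rfl,
      add_row_le hR b.1.val b.1.isLt b.2.val b.2.isLt hd h0⟩
  constructor
  · funext b
    obtain ⟨q, hq0, hqc, hq⟩ := hbot b
    have h1 : (R q).val + 1 ≤ height μ b.2.val := by
      rw [← Fin.card_Iic]
      -- The value of g on rows that do not reach the column is irrelevant.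
      let g : Fin d → Fin d := fun r =>
        if h : b.2.val < μ.1 r then R ⟨r, ⟨b.2.val, h⟩⟩ else r
      refine Finset.card_le_card_of_surjOn g fun v hv => ?_
      obtain ⟨a, ha, hav, _⟩ := exists_mem_column hR hy hw hq0 (Finset.mem_Iic.mp hv)
      have hlt : b.2.val < μ.1 a.1 := by rw [← hqc, ← ha]; exact a.2.isLt
      refine ⟨a.1, by simpa using hlt, ?_⟩
      simp only [g, dif_pos hlt]
      rw [← hav]
      exact congrArg R (Cell.ext' rfl (by simp [ha, hqc]))
    have h2 := row_lt_height b
    have h3 := height_le_add_row hR (height μ b.2.val - 1 - b.1.val) b (by omega)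
    ext
    simp only [stdFilling]
    omega
  · refine Finset.eq_empty_of_forall_notMem fun b hb => ?_
    obtain ⟨q, hq0, hqc, hq⟩ := hbot b
    obtain ⟨a, ha, hav, haB⟩ := exists_mem_column hR hy hw hq0
      (show R b ≤ R q by rw [Fin.le_def]; omega)
    rw [hR.eq_of_col_eq (ha.trans hqc) hav] at haB
    exact haB hb

theorem alternant_zero_mul_factorialSchur (μ : Partition d) :
    alternant (zeroPartition d) * factorialSchur μ = alternant μ := by
  rw [alternant_mul_factorialSchur, Finset.sum_eq_single (stdFilling μ, ∅)]
  · simp only [term, weight, Finset.prod_empty, C_1, one_mul, unbarred_stdFilling, alternant]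
    congr 2
    funext k
    simp only [zeroPartition]
    omega
  · intro T hT hne
    have h := (Finset.mem_filter.mp hT).2
    have hw : weight (zeroPartition d) T.1 T.2 = 0 := by
      by_contra hw
      obtain ⟨h1, h2⟩ := eq_stdFilling h.1 h.2 hw
      exact hne (Prod.ext h1 h2)
    rw [term, hw, C_0, zero_mul]
  · intro h
    exact absurd (Finset.mem_filter.mpr
      ⟨Finset.mem_univ _, isReverseTableau_stdFilling μ, isYam_stdFilling μ⟩) h

/-! ### Existence and uniqueness of the structure constants -/

/-- The partition obtained by adding the unbarred content to `lam`. -/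
def shape (lam : Partition d) (T : (Cell μ → Fin d) × Finset (Cell μ)) : Partition d :=
  if h : Antitone fun k => lam.1 k + unbarred T.1 T.2 k then ⟨_, h⟩ else lam

theorem shape_apply {T : (Cell μ → Fin d) × Finset (Cell μ)} (hT : T ∈ yamFillings lam μ)
    (k : Fin d) : (shape lam T).1 k = lam.1 k + unbarred T.1 T.2 k := by
  rw [shape, dif_pos (antitone_add_unbarred (Finset.mem_filter.mp hT).2.2)]

theorem term_eq {T : (Cell μ → Fin d) × Finset (Cell μ)} (hT : T ∈ yamFillings lam μ) :
    term lam T = C (weight lam T.1 T.2) * alternant (shape lam T) := by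
  rw [term, alternant]
  congr 3
  funext k
  rw [shape_apply hT]
  omega

theorem factorialSchur_mul_factorialSchur (lam μ : Partition d) :
    factorialSchur lam * factorialSchur μ =
      ∑ T ∈ yamFillings lam μ, C (weight lam T.1 T.2) * factorialSchur (shape lam T) := by
  refine mul_left_cancel₀ (alternant_zero_ne_zero d) ?_
  rw [← mul_assoc, alternant_zero_mul_factorialSchur, alternant_mul_factorialSchur, Finset.mul_sum]
  refine Finset.sum_congr rfl fun T hT => ?_
  rw [term_eq hT, mul_left_comm, alternant_zero_mul_factorialSchur]

/-- The structure constants. -/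
def structureConstants (lam μ : Partition d) : Partition d →₀ YRing :=
  ∑ T ∈ yamFillings lam μ, Finsupp.single (shape lam T) (weight lam T.1 T.2)

theorem isStructureConstants_structureConstants (lam μ : Partition d) :
    IsStructureConstants lam μ (structureConstants lam μ) := by
  rw [IsStructureConstants, factorialSchur_mul_factorialSchur, structureConstants,
    ← Finsupp.sum_finsetSum_index]
  · refine Finset.sum_congr rfl fun T _ => ?_
    rw [Finsupp.sum_single_index (by simp)]
  · simp
  · intro ν a b; rw [C_add, add_mul]

/-- Multiplying by a_ρ turns factorial Schur functions into alternants, which are linearly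
independent. -/
theorem IsStructureConstants.unique {lam μ : Partition d} {c c' : Partition d →₀ YRing}
    (h : IsStructureConstants lam μ c) (h' : IsStructureConstants lam μ c') : c = c' := by
  rw [← sub_eq_zero]
  refine eq_zero_of_sum_alternant _ ?_
  rw [IsStructureConstants] at h h'
  have h1 : ∀ e : Partition d →₀ YRing, (e.sum fun ν a => C a * alternant ν) =
      alternant (zeroPartition d) * e.sum fun ν a => C a * factorialSchur ν := by
    intro e
    rw [Finsupp.sum, Finsupp.sum, Finset.mul_sum]
    refine Finset.sum_congr rfl fun ν _ => ?_
    rw [← alternant_zero_mul_factorialSchur ν, mul_left_comm]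
  rw [Finsupp.sum_sub_index fun ν a b => by rw [C_sub, sub_mul], h1, h1, ← h, ← h', sub_self]

end

/-! ### Translation to skew barred tableaux -/

theorem card_filter_sum {α β : Type*} [Fintype α] [Fintype β] (p : α ⊕ β → Prop)
    [DecidablePred p] :
    (Finset.univ.filter p).card = (Finset.univ.filter fun a => p (Sum.inl a)).card +
      (Finset.univ.filter fun b => p (Sum.inr b)).card := by
  simp only [Finset.card_filter, Fintype.sum_sum_type]

section
variable {d : ℕ} {lam μ : Partition d}

theorem card_row (lam : Partition d) (k : Fin d) :
    (Finset.univ.filter fun b : Cell lam => b.1 = k).card = lam.1 k := by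
  rw [Finset.card_filter, Fintype.sum_sigma]
  simp [apply_ite Finset.card]

theorem not_isBarred_inl (L : Filling lam μ) (b : Cell lam) : ¬ IsBarred L (Sum.inl b) := by
  rintro ⟨_, _, h⟩
  cases h

theorem isBarred_inr_iff (L : Filling lam μ) (b : Cell μ) :
    IsBarred L (Sum.inr b) ↔ b ∈ L.2 := by
  constructor
  · rintro ⟨b', hb', h⟩
    rw [Sum.inr_injective h]
    exact hb'
  · exact fun h => ⟨b, h, rfl⟩

theorem readBefore_inr_inr {b q : Cell μ} :
    ReadBefore (Sum.inr b : Box lam μ) (Sum.inr q) ↔ key b < key q := by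
  rw [key_lt_iff, ReadBefore, Fin.lt_def]
  simp only [Box.xpos, Box.ypos, Cell.row, Cell.col]
  omega

theorem readBefore_inl_inr (b : Cell lam) (q : Cell μ) :
    ReadBefore (Sum.inl b : Box lam μ) (Sum.inr q) := by
  left
  simp only [Box.xpos, Cell.col]
  omega

theorem not_readBefore_inr_inl (b : Cell μ) (q : Cell lam) :
    ¬ ReadBefore (Sum.inr b : Box lam μ) (Sum.inl q) := by
  simp only [ReadBefore, Box.xpos, Box.ypos, Cell.row, Cell.col]
  omega

theorem readBefore_inl_inl {b q : Cell lam} :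
    ReadBefore (Sum.inl b : Box lam μ) (Sum.inl q) ↔
      q.2.val < b.2.val ∨ (b.2.val = q.2.val ∧ b.1 < q.1) := by
  rw [ReadBefore, Fin.lt_def]
  simp only [Box.xpos, Box.ypos, Cell.row, Cell.col]
  omega

/-- The filling of `lam * μ` with entries `k` in row `k` of `lam`. -/
def toFilling (lam : Partition d) (T : (Cell μ → Fin d) × Finset (Cell μ)) : Filling lam μ :=
  (Sum.elim (fun b => b.1) T.1, T.2)

theorem toFilling_injective : Function.Injective (toFilling (μ := μ) lam) := by
  intro T T' h
  have h2 : T.2 = T'.2 := congrArg (fun L : Filling lam μ => L.2) h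
  refine Prod.ext (funext fun b => ?_) h2
  exact congrFun (congrArg Prod.fst h) (Sum.inr b)

variable (T : (Cell μ → Fin d) × Finset (Cell μ))

theorem content_toFilling (k : Fin d) :
    content (toFilling lam T) k = lam.1 k + unbarred T.1 T.2 k := by
  rw [content, card_filter_sum, unbarred, ← card_row lam k]
  simp only [not_isBarred_inl, isBarred_inr_iff, toFilling, Sum.elim_inl, Sum.elim_inr,
    not_false_eq_true, true_and]

theorem contentBefore_toFilling (q : Cell μ) (k : Fin d) :
    contentBefore (toFilling lam T) (Sum.inr q) k = lam.1 k + unbarredBefore T.1 T.2 q k := by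
  rw [contentBefore, card_filter_sum, unbarredBefore, ← card_row lam k]
  simp only [not_isBarred_inl, isBarred_inr_iff, toFilling, Sum.elim_inl, Sum.elim_inr,
    not_false_eq_true, true_and, readBefore_inl_inr, readBefore_inr_inr, and_true]

theorem contentUpTo_toFilling (q : Cell μ) (k : Fin d) :
    contentUpTo (toFilling lam T) (Sum.inr q) k = lam.1 k + unbarredUpTo T.1 T.2 q k := by
  have h : ∀ b : Cell μ, (key b < key q ∨ (Sum.inr b : Box lam μ) = Sum.inr q) ↔
      key b ≤ key q := by
    intro b
    rw [Sum.inr.injEq, le_iff_lt_or_eq, key_injective.eq_iff]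
  rw [contentUpTo, card_filter_sum, unbarredUpTo, ← card_row lam k]
  simp only [not_isBarred_inl, isBarred_inr_iff, toFilling, Sum.elim_inl, Sum.elim_inr,
    not_false_eq_true, true_and, readBefore_inl_inr, readBefore_inr_inr, and_true, true_or, h]

/-- Each k' read in λ lies in a column with a k in the row above, read earlier. -/
theorem contentUpTo_toFilling_inl_le (q : Cell lam) {k k' : Fin d} (hk : k'.val = k.val + 1) :
    contentUpTo (toFilling lam T) (Sum.inl q) k' ≤ contentUpTo (toFilling lam T) (Sum.inl q) k := by
  have h0 : ∀ b : Cell μ, ¬ (ReadBefore (Sum.inr b : Box lam μ) (Sum.inl q) ∨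
      (Sum.inr b : Box lam μ) = Sum.inl q) := by
    rintro b (h | h)
    · exact not_readBefore_inr_inl b q h
    · cases h
  rw [contentUpTo, contentUpTo, card_filter_sum, card_filter_sum]
  simp only [h0, and_false, Finset.filter_false, Finset.card_empty, add_zero, not_isBarred_inl,
    not_false_eq_true, true_and, toFilling, Sum.elim_inl]
  have hle : k ≤ k' := by rw [Fin.le_def]; omega
  let g : Cell lam → Cell lam := fun b =>
    if h : b.1 = k' then ⟨k, ⟨b.2.val, b.2.isLt.trans_le (lam.2 (h ▸ hle))⟩⟩ else b
  have hg : ∀ b : Cell lam, b.1 = k' → (g b).1 = k ∧ (g b).2.val = b.2.val := by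
    intro b hb
    have h : g b = ⟨k, ⟨b.2.val, b.2.isLt.trans_le (lam.2 (hb ▸ hle))⟩⟩ := dif_pos hb
    rw [h]
    exact ⟨rfl, rfl⟩
  refine Finset.card_le_card_of_injOn g ?_ ?_
  · intro b hb
    simp only [Finset.coe_filter, Finset.mem_univ, true_and, Set.mem_ofPred_eq] at hb ⊢
    obtain ⟨h1, h2⟩ := hg b hb.1
    refine ⟨h1, Or.inl (readBefore_inl_inl.mpr ?_)⟩
    have hb1 := congrArg Fin.val hb.1
    rw [h2, h1]
    rcases hb.2 with h | h
    · rcases readBefore_inl_inl.mp h with h | h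
      · exact Or.inl h
      · refine Or.inr ⟨h.1, lt_of_le_of_lt ?_ h.2⟩
        rw [hb.1]; exact hle
    · obtain rfl := Sum.inl_injective h
      refine Or.inr ⟨rfl, ?_⟩
      rw [Fin.lt_def]; omega
  · intro b hb b' hb' h
    simp only [Finset.coe_filter, Finset.mem_univ, true_and, Set.mem_ofPred_eq] at hb hb'
    refine Cell.ext' (hb.1.trans hb'.1.symm) ?_
    rw [← (hg b hb.1).2, ← (hg b' hb'.1).2, h]

theorem isYamanouchi_toFilling_iff :
    IsYamanouchi (toFilling lam T) ↔ ∀ q, IsYam lam T.1 T.2 q := by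
  constructor
  · intro h q k k' hk
    have := h (Sum.inr q) k k' hk
    rwa [contentUpTo_toFilling, contentUpTo_toFilling] at this
  · rintro h (q | q) k k' hk
    · exact contentUpTo_toFilling_inl_le T q hk
    · rw [contentUpTo_toFilling, contentUpTo_toFilling]
      exact h q k k' hk

/-- The two diagrams share no row and no column of the plane, and the filling of λ satisfies the
conditions by construction. -/
theorem isSkewBarredTableau_toFilling_iff :
    IsSkewBarredTableau (toFilling lam T) ↔ IsReverseTableau T.1 := by
  constructor
  · rintro ⟨h1, h2⟩
    refine ⟨fun b b' hr hc => h1 (Sum.inr b) (Sum.inr b') ?_ ?_,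
      fun b b' hc hr => h2 (Sum.inr b) (Sum.inr b') ?_ ?_⟩ <;>
      simp only [Box.xpos, Box.ypos] <;> omega
  · rintro ⟨h1, h2⟩
    constructor
    · rintro (p | p) (q | q) hy hx
      · have : p.1.val = q.1.val := by
          simp only [Box.ypos, Cell.row] at hy; omega
        exact this.le
      · have := q.1.isLt
        have := p.1.isLt
        simp only [Box.ypos, Cell.row] at hy; omega
      · have := q.1.isLt
        have := p.1.isLt
        simp only [Box.ypos, Cell.row] at hy; omega
      · simp only [Box.ypos, Box.xpos] at hy hx
        exact h1 p q (by omega) (by omega)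
    · rintro (p | p) (q | q) hx hy
      · have : p.1.val < q.1.val := by
          simp only [Box.ypos, Cell.row] at hy; omega
        exact this
      · simp only [Box.xpos, Cell.col] at hx; omega
      · simp only [Box.xpos, Cell.col] at hx; omega
      · simp only [Box.ypos, Box.xpos] at hy hx
        exact h2 p q (by omega) (by omega)

theorem factor_toFilling (b : Cell μ) :
    factor (toFilling lam T) b =
      y (flip (T.1 b) + (lam.1 (T.1 b) + unbarredBefore T.1 T.2 b (T.1 b))) -
        y (index (T.1 b) b) := by
  rw [factor, contentBefore_toFilling]
  rfl

theorem coeff_toFilling : coeff (toFilling lam T) = weight lam T.1 T.2 :=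
  Finset.prod_congr rfl fun b _ => factor_toFilling T b

/-- In a skew barred tableau with Yamanouchi unbarred word, the rows of `lam` are constant. -/
theorem apply_inl_eq {L : Filling lam μ} (hL : IsSkewBarredTableau L) (hy : IsYamanouchi L)
    (b : Cell lam) : L.1 (Sum.inl b) = b.1 := by
  have hlow : ∀ (r : ℕ) (b : Cell lam), b.1.val = r → r ≤ (L.1 (Sum.inl b)).val := by
    intro r
    induction r with
    | zero => exact fun _ _ => Nat.zero_le _
    | succ r ih =>
      intro b hb
      have hr : r < d := by have := b.1.isLt; omega
      have hle : (⟨r, hr⟩ : Fin d) ≤ b.1 := by rw [Fin.le_def]; simp; omega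
      let a : Cell lam := ⟨⟨r, hr⟩, ⟨b.2.val, b.2.isLt.trans_le (lam.2 hle)⟩⟩
      have h1 := ih a rfl
      have h2 : L.1 (Sum.inl a) < L.1 (Sum.inl b) := hL.2 _ _ rfl (by
        simp only [Box.ypos, Cell.row, a]; omega)
      rw [Fin.lt_def] at h2
      omega
  have hup : ∀ (r : ℕ) (b : Cell lam), b.1.val = r → (L.1 (Sum.inl b)).val ≤ r := by
    intro r
    induction r using Nat.strong_induction_on with
    | _ r ih =>
      intro b hb
      have hpos : lam.1 b.1 - 1 < lam.1 b.1 := by have := b.2.isLt; omega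
      -- At the rightmost cell q of row r, an entry v > r requires an earlier v - 1. Cells of λ read
      -- before q lie in higher rows, where entries are smaller than r by induction.
      let q : Cell lam := ⟨b.1, ⟨lam.1 b.1 - 1, hpos⟩⟩
      have h1 : L.1 (Sum.inl b) ≤ L.1 (Sum.inl q) := hL.1 _ _ rfl (by
        have := b.2.isLt
        simp only [Box.xpos, Cell.col, q]; omega)
      rw [Fin.le_def] at h1
      refine h1.trans ?_
      by_contra hcon
      have hv : (L.1 (Sum.inl q)).val - 1 < d := by have := (L.1 (Sum.inl q)).isLt; omega
      have h2 := hy (Sum.inl q) ⟨(L.1 (Sum.inl q)).val - 1, hv⟩ (L.1 (Sum.inl q)) (by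
        simp only; omega)
      have h3 : 0 < contentUpTo L (Sum.inl q) (L.1 (Sum.inl q)) :=
        Finset.card_pos.mpr ⟨Sum.inl q, Finset.mem_filter.mpr
          ⟨Finset.mem_univ _, not_isBarred_inl L q, rfl, Or.inr rfl⟩⟩
      obtain ⟨p, hp⟩ := Finset.card_pos.mp (h3.trans_le h2)
      obtain ⟨_, _, hpv, hpq⟩ := Finset.mem_filter.mp hp
      have hpv' := congrArg Fin.val hpv
      simp only at hpv'
      rcases hpq with hpq | rfl
      · rcases p with p | p
        · have hlt : p.1 < b.1 := by
            rcases readBefore_inl_inl.mp hpq with h | h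
            · by_contra hle
              have h4 := lam.2 (not_lt.mp hle)
              have h5 := p.2.isLt
              simp only [q] at h
              omega
            · exact h.2
          rw [Fin.lt_def] at hlt
          have := ih p.1.val (by omega) p rfl
          omega
        · exact not_readBefore_inr_inl p q hpq
      · omega
  exact Fin.ext (le_antisymm (hup _ b rfl) (hlow _ b rfl))

theorem eq_toFilling {L : Filling lam μ} (hL : IsSkewBarredTableau L) (hy : IsYamanouchi L) :
    L = toFilling lam (fun b => L.1 (Sum.inr b), L.2) := by
  refine Prod.ext (funext fun p => ?_) rfl
  rcases p with b | b
  · exact apply_inl_eq hL hy b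
  · rfl

theorem mem_LR_iff (ν : Partition d) (L : Filling lam μ) :
    L ∈ LR lam μ ν ↔ ∃ T ∈ yamFillings lam μ, shape lam T = ν ∧ toFilling lam T = L := by
  simp only [LR, Finset.mem_filter, Finset.mem_univ, true_and]
  constructor
  · rintro ⟨h1, h2, h3⟩
    have h4 := eq_toFilling h1 h2
    generalize (fun b => L.1 (Sum.inr b), L.2) = T at h4
    subst h4
    have hT : T ∈ yamFillings lam μ := Finset.mem_filter.mpr ⟨Finset.mem_univ _,
      (isSkewBarredTableau_toFilling_iff T).mp h1, (isYamanouchi_toFilling_iff T).mp h2⟩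
    refine ⟨T, hT, Subtype.ext (funext fun k => ?_), rfl⟩
    rw [shape_apply hT, ← content_toFilling, h3]
  · rintro ⟨T, hT, rfl, rfl⟩
    have hT' := (Finset.mem_filter.mp hT).2
    refine ⟨(isSkewBarredTableau_toFilling_iff T).mpr hT'.1,
      (isYamanouchi_toFilling_iff T).mpr hT'.2, fun k => ?_⟩
    rw [shape_apply hT, content_toFilling]

/-- This is why the restriction to c_L > 0 loses nothing: the discarded c_L vanish. -/
theorem coeffPos_of_coeff_ne_zero {ν : Partition d} {L : Filling lam μ} (hL : L ∈ LR lam μ ν)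
    (h : coeff L ≠ 0) : CoeffPos L := by
  obtain ⟨T, hT, _, rfl⟩ := (mem_LR_iff ν L).mp hL
  have hT' := (Finset.mem_filter.mp hT).2
  rw [coeff_toFilling] at h
  intro b hb
  have h1 := index_lt_of_weight_ne_zero hT'.1 hT'.2 h hb
  have h2 := index_pos hT'.1 b
  have h3 : 0 < index (T.1 b) b := Nat.sub_pos_of_lt h2
  rw [factor_toFilling]
  refine ⟨_, _, ?_, rfl⟩
  rw [← PNat.coe_lt_coe, Nat.toPNat'_coe, Nat.toPNat'_coe, if_pos h3, if_pos (h3.trans h1)]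
  exact h1

theorem structureConstants_apply (lam μ ν : Partition d) :
    structureConstants lam μ ν = ∑ L ∈ LRPos lam μ ν, coeff L := by
  rw [LRPos, Finset.sum_filter_of_ne fun L hL => coeffPos_of_coeff_ne_zero hL, structureConstants,
    Finsupp.finsetSum_apply]
  simp only [Finsupp.single_apply]
  rw [← Finset.sum_filter]
  refine Finset.sum_bij (fun T _ => toFilling lam T) ?_ ?_ ?_ ?_
  · intro T hT
    obtain ⟨h1, h2⟩ := Finset.mem_filter.mp hT
    exact (mem_LR_iff ν _).mpr ⟨T, h1, h2, rfl⟩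
  · intro T _ T' _ h
    exact toFilling_injective h
  · intro L hL
    obtain ⟨T, h1, h2, h3⟩ := (mem_LR_iff ν L).mp hL
    exact ⟨T, Finset.mem_filter.mpr ⟨h1, h2⟩, h3⟩
  · intro T _
    exact (coeff_toFilling T).symm

theorem exists_multiset_of_mem_LRPos {ν : Partition d} {L : Filling lam μ}
    (hL : L ∈ LRPos lam μ ν) :
    ∃ I : Multiset (ℕ+ × ℕ+), (∀ p ∈ I, p.2 < p.1) ∧
      coeff L = (I.map fun p => (X p.1 - X p.2 : YRing)).prod := by
  have h : CoeffPos L := (Finset.mem_filter.mp hL).2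
  choose! i j hij using h
  refine ⟨L.2.val.map fun b => (i b, j b), fun p hp => ?_, ?_⟩
  · obtain ⟨b, hb, rfl⟩ := Multiset.mem_map.mp hp
    exact (hij b hb).1
  · rw [Multiset.map_map]
    exact Finset.prod_congr rfl fun b hb => (hij b hb).2

end

end

end EquivLR

theorem corollary2p4 (d : ℕ) (hd : 0 < d) (lam μ : EquivLR.Partition d) :
    (∃! c : EquivLR.Partition d →₀ EquivLR.YRing, EquivLR.IsStructureConstants lam μ c) ∧
    (∀ c : EquivLR.Partition d →₀ EquivLR.YRing, EquivLR.IsStructureConstants lam μ c →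
      ∀ ν : EquivLR.Partition d, c ν = ∑ L ∈ EquivLR.LRPos lam μ ν, EquivLR.coeff L) ∧
    (∀ ν : EquivLR.Partition d, ∀ L ∈ EquivLR.LRPos lam μ ν,
      ∃ I : Multiset (ℕ+ × ℕ+), (∀ p ∈ I, p.2 < p.1) ∧
        EquivLR.coeff L =
          (I.map fun p => (MvPolynomial.X p.1 - MvPolynomial.X p.2 : EquivLR.YRing)).prod) := by
  have h := EquivLR.isStructureConstants_structureConstants lam μ
  refine ⟨⟨_, h, fun c hc => hc.unique h⟩, fun c hc ν => ?_, fun ν L hL => ?_⟩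
  · rw [hc.unique h]
    exact EquivLR.structureConstants_apply lam μ ν
  · exact EquivLR.exists_multiset_of_mem_LRPos hL
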